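/- Fix $P,\Delta f>0$ and $\varepsilon,\tau\ge 0$. For integers $N,B,L\ge 1$ and $a\ge 0$ let $\mathbf Y=\sqrt a\,\mathbf h\mathbf u^{H}+\mathbf Z\in\mathbb C^{N\times L}$, where $\mathbf u$ is uniformly distributed on the unit sphere of $\mathbb C^{L}$, $\mathbf h\in\mathbb C^{N}$ and $\mathbf Z\in\mathbb C^{N\times L}$ have i.i.d. $\mathcal{CN}(0,1)$ entries, and $\mathbf u,\mathbf h,\mathbf Z$ are independent. Let $I(\mathbf u;\mathbf Y\mid a)$ denote the mutual information of $\mathbf u$ and $\mathbf Y$ for this value of $a$, and define the shape-encoding capacity $$C_S(B,N,L)=\sup_{1\le M\le B}\ \sup_{p(a):\,a\ge 0,\ \mathbb E[a]\le PL/M}\ \frac{M\,\Delta f}{L}\ \mathbb E_{a\sim p}\big[I(\mathbf u;\mathbf Y\mid a)\big].$$ Let $B=B(N)\ge1$ and $L=L(N)\ge1$ be integers depending on $N$, and put $x=\min\left(\varepsilon,\tfrac{1+\tau}{2},1\right)$. (1) If $\log B/\log N\to\varepsilon$ and $\log L/\log N\to\tau$ as $N\to\infty$, then $C_S(B,N,L)$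 has scaling exponent at most $x$: for every $\delta>0$, $C_S(B,N,L)\le N^{x+\delta}$ for all sufficiently large $N$. (2) If $B=\Theta(N^{\varepsilon})$ and $L=\Theta(N^{\tau})$ up to constant factors, then $C_S(B,N,L)=O(N^{x}\log N)$; and if moreover $\varepsilon\ge\min\left(\tfrac{1+\tau}{2},1\right)$, then $C_S(B,N,L)=O(N^{x})$. -/

import Mathlib

open MeasureTheory ProbabilityTheory Filter Asymptotics
open scoped ENNReal NNReal Topology

noncomputable section

namespace ShapeEncoding

/-- The law `𝒞𝒩(0,1)`: real and imaginary parts are independent `𝒩(0,1/2)`. -/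
def complexGaussian : Measure ℂ :=
  ((gaussianReal 0 (1 / 2)).prod (gaussianReal 0 (1 / 2))).map
    Complex.measurableEquivRealProd.symm

/-- The unit sphere of `ℂ^L` (Euclidean norm). -/
abbrev UnitVec (L : ℕ) : Type :=
  Metric.sphere (0 : EuclideanSpace ℂ (Fin L)) 1

/-- The isotropic law on the unit sphere of `ℂ^L`: normalized surface measure. -/
def isotropic (L : ℕ) : Measure (UnitVec L) :=
  ((volume : Measure (EuclideanSpace ℂ (Fin L))).toSphere Set.univ)⁻¹ •
    (volume : Measure (EuclideanSpace ℂ (Fin L))).toSphere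

/-- The channel output `Y = h xᴴ + Z` for the input `x = √a u`. -/
def channelOutput {N L : ℕ} (a : ℝ≥0) (u : UnitVec L) (h : Fin N → ℂ)
    (Z : Fin N → Fin L → ℂ) : Fin N → Fin L → ℂ :=
  fun n l => h n * star ((Real.sqrt a : ℂ) * u.1 l) + Z n l

/-- The joint law of `(u, Y)` for a fixed energy `a`, where `u` is isotropic, the fading `h` and
the noise `Z` have i.i.d. `𝒞𝒩(0,1)` entries, and `u`, `h`, `Z` are independent. -/
def shapeOutputLaw (N L : ℕ) (a : ℝ≥0) : Measure (UnitVec L × (Fin N → Fin L → ℂ)) :=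
  ((isotropic L).prod
    ((Measure.pi fun _ : Fin N => complexGaussian).prod
      (Measure.pi fun _ : Fin N => Measure.pi fun _ : Fin L => complexGaussian))).map
    fun w => (w.1, channelOutput a w.1 w.2.1 w.2.2)

/-- Mutual information (in nats) of the two components of a pair with joint law `ρ`. -/
def mutualInfo {α β : Type*} [MeasurableSpace α] [MeasurableSpace β]
    (ρ : Measure (α × β)) : ℝ≥0∞ :=
  InformationTheory.klDiv ρ (ρ.fst.prod ρ.snd)

/-- The conditional mutual information `I(u; Y | a)`, averaged over an energy `a ∼ p` that is
independent of `u`, `h` and `Z`. -/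
def shapeInfo (N L : ℕ) (p : Measure ℝ≥0) : ℝ≥0∞ :=
  ∫⁻ a, mutualInfo (shapeOutputLaw N L a) ∂p

/-- The shape-encoding capacity: the supremum of `(M Δf / L) · I(u; Y | a)` over the number
`1 ≤ M ≤ B` of active subchannels and all laws `p` of the energy with mean at most `P L / M`. -/
def shapeCapacity (P Δf : ℝ) (B N L : ℕ) : ℝ≥0∞ :=
  ⨆ (M : ℕ) (_ : 1 ≤ M ∧ M ≤ B) (p : Measure ℝ≥0) (_ : IsProbabilityMeasure p)
    (_ : ∫⁻ a, (a : ℝ≥0∞) ∂p ≤ ENNReal.ofReal (P * L / M)),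
    ENNReal.ofReal (M * Δf / L) * shapeInfo N L p

/-- `f` has scaling exponent `s`: `log f(N) / log N → s`. -/
def HasExponent (f : ℕ → ℕ) (s : ℝ) : Prop :=
  Tendsto (fun N : ℕ => Real.log (f N) / Real.log N) atTop (𝓝 s)

/-- `F` has scaling exponent at most `s`: `limsup log F(N) / log N ≤ s`. -/
def ExponentAtMost (F : ℕ → ℝ≥0∞) (s : ℝ) : Prop :=
  ∀ δ : ℝ, 0 < δ → ∀ᶠ N : ℕ in atTop, F N ≤ ENNReal.ofReal ((N : ℝ) ^ (s + δ))

/-- `F(N) ≤ C g(N)` for all large `N`, with some constant `C`. -/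
def AtMostOrder (F : ℕ → ℝ≥0∞) (g : ℕ → ℝ) : Prop :=
  ∃ C : ℝ, ∀ᶠ N : ℕ in atTop, F N ≤ ENNReal.ofReal (C * g N)

end ShapeEncoding

end

/-! Everything follows from bounds on `I(u; Y | a)` that are affine in `a`. The mutual information
is the mean of the log ratio of the conditional output density to the mixture density. Keeping only
the directions in a neighbourhood `S u` of mass at least `θ` and applying Jensen bounds the mixture
from below, which gives `I ≤ -log θ + D` when the output laws for directions in `S u` are within
divergence `D` of the law given `u`. This is covering with a local prior and needs no net.

Integrating out the fading makes the output given `u` Gaussian, with log-likelihood an affine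
function of the energies `‖rowProj u (y n)‖ ^ 2`. The divergence between directions `u` and `u'` is
then `N a²/(1+a) (1 - |⟨u,u'⟩|²)`, at most `N a²/(1+a) r²` on a cap of radius `r`, while a cap has
mass at least `(r/4)^(2L)` because the sphere lies in real dimension `2L`. Hence `I ≤ L log(16/r²) +
N a²/(1+a) r²` for `0 < r ≤ 2`.

Three choices of neighbourhood matter. The whole sphere gives `9 N a`; `r² = 1/N` gives `L log(16N)
+ a`; and `r² = L/(a² N)`, replaced by the whole sphere when `a` is small, gives `9 √(NL) a`. In `c
+ d a` the energy constraint `E a ≤ PL/M` cancels the prefactor `M/L` of the linear term, so the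
capacity is at most `Δf (B c/L + d P)` whatever `M` and the law of `a`. The resulting orders `N`, `B
log N` and `√(NL)` account for the three exponents; the logarithm comes only from the bandwidth
bound. -/

noncomputable section

namespace ShapeEncoding

/-! ### Mutual information of a joint law given by a log-density -/

section Density

variable {α β : Type*} [MeasurableSpace α] [MeasurableSpace β]
  {μ : Measure α} {ν : Measure β} [IsProbabilityMeasure ν]
  {ℓ : α → β → ℝ} {b : β → ℝ}

/-- The joint law with log-density `ℓ` relative to the product `μ ⊗ ν`. -/
def expDensity (μ : Measure α) (ν : Measure β) (ℓ : α → β → ℝ) : Measure (α × β) :=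
  (μ.prod ν).withDensity fun p => ENNReal.ofReal (Real.exp (ℓ p.1 p.2))

/-- The density of the second marginal of `expDensity μ ν ℓ`. -/
def mixDensity (μ : Measure α) (ℓ : α → β → ℝ) (y : β) : ℝ :=
  ∫ u, Real.exp (ℓ u y) ∂μ

lemma measurable_ofReal_exp (hℓ : Measurable (Function.uncurry ℓ)) :
    Measurable fun p : α × β => ENNReal.ofReal (Real.exp (ℓ p.1 p.2)) :=
  (Real.measurable_exp.comp hℓ).ennreal_ofReal

lemma fst_expDensity (hℓ : Measurable (Function.uncurry ℓ))
    (h1 : ∀ u, ∫⁻ y, ENNReal.ofReal (Real.exp (ℓ u y)) ∂ν = 1) :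
    (expDensity μ ν ℓ).fst = μ := by
  have hm := measurable_ofReal_exp hℓ
  refine Measure.ext_of_lintegral _ fun φ hφ => ?_
  rw [Measure.fst, lintegral_map hφ measurable_fst, expDensity,
    lintegral_withDensity_eq_lintegral_mul _ hm (by fun_prop),
    lintegral_prod _ (by fun_prop)]
  refine lintegral_congr fun u => ?_
  simp only [Pi.mul_apply]
  rw [lintegral_mul_const _ (by fun_prop), h1, one_mul]

variable [IsProbabilityMeasure μ]

/-- The envelope `b` is uniform in `u`, so for fixed `y` the density is bounded in `u`, hence
integrable for a probability measure. The same envelope controls the logarithm of the mixture. -/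
lemma integrable_exp_logDensity (hℓ : Measurable (Function.uncurry ℓ))
    (hb : ∀ u y, |ℓ u y| ≤ b y) (y : β) : Integrable (fun u => Real.exp (ℓ u y)) μ := by
  have hm : Measurable fun u => ℓ u y := hℓ.of_uncurry_right
  refine Integrable.of_bound (C := Real.exp (b y)) (by fun_prop) (ae_of_all _ fun u => ?_)
  simpa using (le_abs_self _).trans (hb u y)

lemma exp_neg_le_mixDensity (hℓ : Measurable (Function.uncurry ℓ))
    (hb : ∀ u y, |ℓ u y| ≤ b y) (y : β) : Real.exp (-b y) ≤ mixDensity μ ℓ y := by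
  have := integral_mono (μ := μ) (integrable_const (Real.exp (-b y)))
    (integrable_exp_logDensity hℓ hb y)
    (fun u => Real.exp_le_exp.2 (neg_le_of_abs_le (hb u y)))
  simpa [mixDensity] using this

lemma mixDensity_le_exp (hℓ : Measurable (Function.uncurry ℓ))
    (hb : ∀ u y, |ℓ u y| ≤ b y) (y : β) : mixDensity μ ℓ y ≤ Real.exp (b y) := by
  have := integral_mono (μ := μ) (integrable_exp_logDensity hℓ hb y)
    (integrable_const (Real.exp (b y)))
    (fun u => Real.exp_le_exp.2 (le_of_abs_le (hb u y)))
  simpa [mixDensity] using this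

lemma mixDensity_pos (hℓ : Measurable (Function.uncurry ℓ))
    (hb : ∀ u y, |ℓ u y| ≤ b y) (y : β) : 0 < mixDensity μ ℓ y :=
  (Real.exp_pos _).trans_le (exp_neg_le_mixDensity hℓ hb y)

lemma abs_log_mixDensity_le (hℓ : Measurable (Function.uncurry ℓ))
    (hb : ∀ u y, |ℓ u y| ≤ b y) (y : β) : |Real.log (mixDensity μ ℓ y)| ≤ b y := by
  have hpos := mixDensity_pos (μ := μ) hℓ hb y
  rw [abs_le]
  exact ⟨(Real.le_log_iff_exp_le hpos).2 (exp_neg_le_mixDensity hℓ hb y),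
    (Real.log_le_iff_le_exp hpos).2 (mixDensity_le_exp hℓ hb y)⟩

lemma measurable_mixDensity (hℓ : Measurable (Function.uncurry ℓ)) :
    Measurable (mixDensity μ ℓ) := by
  have : StronglyMeasurable (Function.uncurry fun (y : β) (u : α) => Real.exp (ℓ u y)) :=
    (Real.measurable_exp.comp (hℓ.comp measurable_swap)).stronglyMeasurable
  exact this.integral_prod_right.measurable

lemma ofReal_mixDensity (hℓ : Measurable (Function.uncurry ℓ))
    (hb : ∀ u y, |ℓ u y| ≤ b y) (y : β) :
    ENNReal.ofReal (mixDensity μ ℓ y) = ∫⁻ u, ENNReal.ofReal (Real.exp (ℓ u y)) ∂μ :=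
  ofReal_integral_eq_lintegral_ofReal (integrable_exp_logDensity hℓ hb y)
    (ae_of_all _ fun _ => (Real.exp_pos _).le)

lemma snd_expDensity (hℓ : Measurable (Function.uncurry ℓ)) (hb : ∀ u y, |ℓ u y| ≤ b y) :
    (expDensity μ ν ℓ).snd = ν.withDensity fun y => ENNReal.ofReal (mixDensity μ ℓ y) := by
  have hm := measurable_ofReal_exp hℓ
  refine Measure.ext_of_lintegral _ fun φ hφ => ?_
  rw [Measure.snd, lintegral_map hφ measurable_snd, expDensity,
    lintegral_withDensity_eq_lintegral_mul _ hm (by fun_prop),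
    lintegral_prod_symm _ (by fun_prop),
    lintegral_withDensity_eq_lintegral_mul _ (measurable_mixDensity hℓ).ennreal_ofReal hφ]
  refine lintegral_congr fun y => ?_
  simp only [Pi.mul_apply]
  rw [lintegral_mul_const _ (by fun_prop), ofReal_mixDensity hℓ hb]

lemma isProbabilityMeasure_expDensity (hℓ : Measurable (Function.uncurry ℓ))
    (h1 : ∀ u, ∫⁻ y, ENNReal.ofReal (Real.exp (ℓ u y)) ∂ν = 1) :
    IsProbabilityMeasure (expDensity μ ν ℓ) := by
  constructor
  rw [← Measure.fst_univ, fst_expDensity hℓ h1, measure_univ]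

/-- The mutual information as the mean of the information density. -/
lemma mutualInfo_expDensity (hℓ : Measurable (Function.uncurry ℓ))
    (hb : ∀ u y, |ℓ u y| ≤ b y)
    (h1 : ∀ u, ∫⁻ y, ENNReal.ofReal (Real.exp (ℓ u y)) ∂ν = 1)
    (hbJoint : Integrable (fun p : α × β => b p.2) (expDensity μ ν ℓ)) :
    Integrable (fun p : α × β => ℓ p.1 p.2 - Real.log (mixDensity μ ℓ p.2))
        (expDensity μ ν ℓ) ∧
      mutualInfo (expDensity μ ν ℓ) = ENNReal.ofReal
        (∫ p, (ℓ p.1 p.2 - Real.log (mixDensity μ ℓ p.2)) ∂(expDensity μ ν ℓ)) := by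
  have hprob := isProbabilityMeasure_expDensity (μ := μ) hℓ h1
  have hg := measurable_mixDensity (μ := μ) hℓ
  have hm := measurable_ofReal_exp hℓ
  have hℓ' : Measurable fun p : α × β => ℓ p.1 p.2 := hℓ
  have hpos := mixDensity_pos (μ := μ) hℓ hb
  set ρ := expDensity μ ν ℓ with hρ
  set π := ρ.fst.prod ρ.snd with hπ
  have hπ' : π = (μ.prod ν).withDensity fun p => ENNReal.ofReal (mixDensity μ ℓ p.2) := by
    rw [hπ, hρ, fst_expDensity hℓ h1, snd_expDensity hℓ hb,
      prod_withDensity_right hg.ennreal_ofReal]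
  have hratio : Measurable fun p : α × β =>
      ENNReal.ofReal (Real.exp (ℓ p.1 p.2) / mixDensity μ ℓ p.2) :=
    ((Real.measurable_exp.comp hℓ').div (hg.comp measurable_snd)).ennreal_ofReal
  -- The joint law and the product of its marginals both have densities relative to `μ.prod ν`, and
  -- the second is positive everywhere, so the quotient is a density of one relative to the other.
  have hρπ : ρ = π.withDensity fun p =>
      ENNReal.ofReal (Real.exp (ℓ p.1 p.2) / mixDensity μ ℓ p.2) := by
    have hg' : Measurable fun p : α × β => ENNReal.ofReal (mixDensity μ ℓ p.2) :=
      (hg.comp measurable_snd).ennreal_ofReal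
    rw [hπ', ← withDensity_mul _ hg' hratio, hρ, expDensity]
    congr 1
    funext p
    simp only [Pi.mul_apply]
    rw [← ENNReal.ofReal_mul (hpos _).le, mul_div_cancel₀ _ (hpos _).ne']
  have hac : ρ ≪ π := by
    rw [hρπ]; exact withDensity_absolutelyContinuous _ _
  have hllr : llr ρ π =ᵐ[ρ] fun p => ℓ p.1 p.2 - Real.log (mixDensity μ ℓ p.2) := by
    have h := Measure.rnDeriv_withDensity π hratio
    rw [← hρπ] at h
    filter_upwards [hac.ae_le h] with p hp
    rw [llr, hp, ENNReal.toReal_ofReal (div_pos (Real.exp_pos _) (hpos _)).le,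
      Real.log_div (Real.exp_pos _).ne' (hpos _).ne', Real.log_exp]
  have hI : Integrable (fun p : α × β => ℓ p.1 p.2 - Real.log (mixDensity μ ℓ p.2)) ρ := by
    refine (hbJoint.add hbJoint).mono' (hℓ'.sub
      (Real.measurable_log.comp (hg.comp measurable_snd))).aestronglyMeasurable
      (ae_of_all _ fun p => ?_)
    exact (abs_sub _ _).trans (add_le_add (hb _ _) (abs_log_mixDensity_le hℓ hb _))
  refine ⟨hI, ?_⟩
  rw [mutualInfo, InformationTheory.klDiv_of_ac_of_integrable hac ((integrable_congr hllr).2 hI),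
    integral_congr_ae hllr]
  simp

/-- Restricting the mixture to `S` and applying Jensen's inequality to the average over `S`. -/
lemma neg_log_mixDensity_le (hℓ : Measurable (Function.uncurry ℓ))
    (hb : ∀ u y, |ℓ u y| ≤ b y) {S : Set α} {θ : ℝ} (hθ : 0 < θ)
    (hθS : θ ≤ μ.real S) (y : β) :
    -Real.log (mixDensity μ ℓ y) ≤ -Real.log θ - ∫ u, ℓ u y ∂μ[|S] := by
  have hS0 : μ S ≠ 0 := by
    intro h; simp [measureReal_def, h] at hθS; linarith
  have := cond_isProbabilityMeasure hS0
  have hm : Measurable fun u => ℓ u y := hℓ.of_uncurry_right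
  have hi : Integrable (fun u => ℓ u y) μ[|S] :=
    Integrable.of_bound (C := b y) (by fun_prop) (ae_of_all _ fun u => hb u y)
  have hje : Real.exp (∫ u, ℓ u y ∂μ[|S]) ≤ ∫ u, Real.exp (ℓ u y) ∂μ[|S] :=
    convexOn_exp.map_integral_le Real.continuous_exp.continuousOn isClosed_univ
      (by simp) hi (integrable_exp_logDensity hℓ hb y)
  have hset : (μ.real S) * ∫ u, Real.exp (ℓ u y) ∂μ[|S] = ∫ u in S, Real.exp (ℓ u y) ∂μ := by
    rw [ProbabilityTheory.cond, integral_smul_measure, ENNReal.toReal_inv, ← measureReal_def,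
      smul_eq_mul, mul_inv_cancel_left₀ (hθ.trans_le hθS).ne']
  have hle : θ * Real.exp (∫ u, ℓ u y ∂μ[|S]) ≤ mixDensity μ ℓ y :=
    calc θ * Real.exp (∫ u, ℓ u y ∂μ[|S])
        ≤ μ.real S * ∫ u, Real.exp (ℓ u y) ∂μ[|S] := by gcongr
      _ = ∫ u in S, Real.exp (ℓ u y) ∂μ := hset
      _ ≤ mixDensity μ ℓ y := setIntegral_le_integral (integrable_exp_logDensity hℓ hb y)
          (ae_of_all _ fun _ => (Real.exp_pos _).le)
  have := Real.log_le_log (by positivity) hle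
  rw [Real.log_mul hθ.ne' (Real.exp_pos _).ne', Real.log_exp] at this
  linarith

/-- If every `u` has a neighbourhood `S u` of mass at least `θ` on which the conditional laws are
within divergence `D` of the law given `u`, the mutual information is at most `-log θ + D`. -/
theorem mutualInfo_expDensity_le (hℓ : Measurable (Function.uncurry ℓ))
    (hb : ∀ u y, |ℓ u y| ≤ b y)
    (h1 : ∀ u, ∫⁻ y, ENNReal.ofReal (Real.exp (ℓ u y)) ∂ν = 1)
    (hbJoint : Integrable (fun p : α × β => b p.2) (expDensity μ ν ℓ))
    (hbCond : ∀ u, Integrable b (ν.withDensity fun y => ENNReal.ofReal (Real.exp (ℓ u y))))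
    {S : α → Set α} (hS : ∀ u, MeasurableSet (S u)) {θ D : ℝ} (hθ : 0 < θ)
    (hθS : ∀ u, θ ≤ μ.real (S u))
    (hD : ∀ u, ∀ u' ∈ S u, ∫ y, (ℓ u y - ℓ u' y)
      ∂(ν.withDensity fun y => ENNReal.ofReal (Real.exp (ℓ u y))) ≤ D) :
    mutualInfo (expDensity μ ν ℓ) ≤ ENNReal.ofReal (-Real.log θ + D) := by
  obtain ⟨hI, heq⟩ := mutualInfo_expDensity hℓ hb h1 hbJoint
  rw [heq]
  refine ENNReal.ofReal_le_ofReal ?_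
  have hm := measurable_ofReal_exp hℓ
  have hg := measurable_mixDensity (μ := μ) hℓ
  rw [expDensity, integrable_withDensity_iff_integrable_smul' hm (ae_of_all _ fun _ => by simp)]
    at hI
  rw [expDensity, integral_withDensity_eq_integral_toReal_smul hm (ae_of_all _ fun _ => by simp),
    integral_prod _ hI]
  have key : ∀ u, ∫ y, (ENNReal.ofReal (Real.exp (ℓ u y))).toReal •
      (ℓ u y - Real.log (mixDensity μ ℓ y)) ∂ν ≤ -Real.log θ + D := by
    intro u
    have hmu : Measurable fun y => ℓ u y := hℓ.of_uncurry_left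
    rw [← integral_withDensity_eq_integral_toReal_smul (by fun_prop)
      (ae_of_all _ fun _ => by simp)]
    set κ := ν.withDensity fun y => ENNReal.ofReal (Real.exp (ℓ u y)) with hκ
    have hκp : IsProbabilityMeasure κ := ⟨by rw [hκ, withDensity_apply _ .univ]; simp [h1]⟩
    have hS0 : μ (S u) ≠ 0 := by
      intro h; have := hθS u; simp [measureReal_def, h] at this; linarith
    have hcp := cond_isProbabilityMeasure hS0
    have hbk : Integrable b κ := hbCond u
    have hprod : Integrable (fun p : α × β => ℓ u p.2 - ℓ p.1 p.2) ((μ[|S u]).prod κ) := by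
      refine ((hbk.comp_snd _).add (hbk.comp_snd _)).mono'
        ((hmu.comp measurable_snd).sub hℓ).aestronglyMeasurable (ae_of_all _ fun p => ?_)
      exact (abs_sub _ _).trans (add_le_add (hb _ _) (hb _ _))
    have hlk : Integrable (fun y => ℓ u y - Real.log (mixDensity μ ℓ y)) κ := by
      refine (hbk.add hbk).mono' (hmu.sub (Real.measurable_log.comp hg)).aestronglyMeasurable
        (ae_of_all _ fun p => ?_)
      exact (abs_sub _ _).trans (add_le_add (hb _ _) (abs_log_mixDensity_le hℓ hb _))
    have hav : Integrable (fun y => ∫ u', (ℓ u y - ℓ u' y) ∂μ[|S u]) κ := hprod.integral_prod_right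
    calc ∫ y, (ℓ u y - Real.log (mixDensity μ ℓ y)) ∂κ
        ≤ ∫ y, (-Real.log θ + ∫ u', (ℓ u y - ℓ u' y) ∂μ[|S u]) ∂κ := by
          refine integral_mono hlk ((integrable_const _).add hav) fun y => ?_
          have h := neg_log_mixDensity_le hℓ hb hθ (hθS u) y
          have hm' : Measurable fun u' => ℓ u' y := hℓ.of_uncurry_right
          have hi : Integrable (fun u' => ℓ u' y) μ[|S u] :=
            Integrable.of_bound (C := b y) (by fun_prop) (ae_of_all _ fun u => hb u y)
          simp only
          rw [integral_sub (integrable_const _) hi]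
          simp
          linarith
      -- After Fubini the inner integral is the divergence of the law given `u` from the law given
      -- `u'`, which `hD` bounds for `u'` in `S u`.
      _ = -Real.log θ + ∫ u', ∫ y, (ℓ u y - ℓ u' y) ∂κ ∂μ[|S u] := by
          rw [integral_add (integrable_const _) hav, integral_integral_swap]
          · simp
          · exact hprod.swap
      _ ≤ -Real.log θ + D := by
          gcongr
          have : ∫ u', ∫ y, (ℓ u y - ℓ u' y) ∂κ ∂μ[|S u] ≤ ∫ u', D ∂μ[|S u] := by
            refine integral_mono_ae hprod.integral_prod_left (integrable_const _) ?_
            filter_upwards [ae_cond_mem (hS u)] with u' hu'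
            exact hD u u' hu'
          simpa using this
  calc _ ≤ ∫ u, (-Real.log θ + D) ∂μ := integral_mono hI.integral_prod_left (integrable_const _) key
    _ = _ := by simp

end Density

/-! ### Densities of finite product measures -/

section PiDensity

variable {ι : Type*} [Fintype ι] {X : ι → Type*} [∀ i, MeasurableSpace (X i)]
  {μ : ∀ i, Measure (X i)} [∀ i, IsProbabilityMeasure (μ i)]

lemma lintegral_pi_prod {f : ∀ i, X i → ℝ≥0∞} (hf : ∀ i, Measurable (f i)) :
    ∫⁻ x, ∏ i, f i (x i) ∂Measure.pi μ = ∏ i, ∫⁻ t, f i t ∂μ i := by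
  have hind : iIndepFun (fun i (x : ∀ i, X i) => f i (x i)) (Measure.pi μ) :=
    iIndepFun_pi fun i => (hf i).aemeasurable
  rw [lintegral_prod_eq_prod_lintegral_of_indepFun Finset.univ _ hind
    fun i => (hf i).comp (measurable_pi_apply i)]
  refine Finset.prod_congr rfl fun i _ => ?_
  exact (measurePreserving_eval μ i).lintegral_comp (hf i)

lemma pi_withDensity {f : ∀ i, X i → ℝ≥0∞} (hf : ∀ i, Measurable (f i))
    [∀ i, SigmaFinite ((μ i).withDensity (f i))] :
    Measure.pi (fun i => (μ i).withDensity (f i)) =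
      (Measure.pi μ).withDensity fun x => ∏ i, f i (x i) := by
  refine Measure.pi_eq fun s hs => ?_
  have hind : (Set.univ.pi s).indicator (fun x : ∀ i, X i => ∏ i, f i (x i)) =
      fun x => ∏ i, (s i).indicator (f i) (x i) := by
    classical
    funext x
    by_cases hx : x ∈ Set.univ.pi s
    · rw [Set.indicator_of_mem hx]
      exact Finset.prod_congr rfl fun i _ => (Set.indicator_of_mem (hx i trivial) _).symm
    · rw [Set.indicator_of_notMem hx]
      simp only [Set.mem_pi, Set.mem_univ, true_imp_iff, not_forall] at hx
      obtain ⟨i, hi⟩ := hx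
      exact (Finset.prod_eq_zero (Finset.mem_univ i) (Set.indicator_of_notMem hi _)).symm
  rw [withDensity_apply _ (.univ_pi hs), ← lintegral_indicator (.univ_pi hs), hind,
    lintegral_pi_prod fun i => (hf i).indicator (hs i)]
  refine Finset.prod_congr rfl fun i _ => ?_
  rw [withDensity_apply _ (hs i), lintegral_indicator (hs i)]

end PiDensity

/-! ### The standard complex Gaussian: density, translation, Gaussian averages -/

section Gaussian

instance : IsProbabilityMeasure complexGaussian :=
  Measure.isProbabilityMeasure_map Complex.measurableEquivRealProd.symm.measurable.aemeasurable

lemma complexGaussian_eq_withDensity :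
    complexGaussian = (volume : Measure ℂ).withDensity
      fun z => ENNReal.ofReal (Real.pi⁻¹ * Real.exp (-‖z‖ ^ 2)) := by
  have hv : (1 / 2 : ℝ≥0) ≠ 0 := by simp
  refine Measure.ext_of_lintegral _ fun φ hφ => ?_
  rw [complexGaussian, lintegral_map hφ (MeasurableEquiv.measurable _),
    gaussianReal_of_var_ne_zero _ hv,
    prod_withDensity (measurable_gaussianPDF _ _) (measurable_gaussianPDF _ _),
    lintegral_withDensity_eq_lintegral_mul _ (by fun_prop) (by fun_prop),
    lintegral_withDensity_eq_lintegral_mul _ (by fun_prop) hφ,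
    ← (Complex.volume_preserving_equiv_real_prod.symm).lintegral_comp (by fun_prop)]
  refine lintegral_congr fun p => ?_
  simp only [Pi.mul_apply]
  congr 1
  rw [gaussianPDF, gaussianPDF, ← ENNReal.ofReal_mul (gaussianPDFReal_nonneg _ _ _)]
  congr 1
  simp only [gaussianPDFReal, Complex.measurableEquivRealProd_symm_apply,
    ← Complex.normSq_eq_norm_sq, Complex.normSq_mk]
  have h2 : (2 * Real.pi * ((1 / 2 : ℝ≥0) : ℝ)) = Real.pi := by push_cast; ring
  have h3 : 2 * ((1 / 2 : ℝ≥0) : ℝ) = 1 := by push_cast; ring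
  rw [h2, h3, mul_mul_mul_comm, ← mul_inv, Real.mul_self_sqrt Real.pi_pos.le, ← Real.exp_add]
  congr 2
  ring

/-- The density of a shifted Gaussian relative to the centred one. -/
def shiftDensity (c z : ℂ) : ℝ≥0∞ :=
  ENNReal.ofReal (Real.exp (2 * (z * star c).re - ‖c‖ ^ 2))

@[fun_prop]
lemma measurable_shiftDensity {α : Type*} [MeasurableSpace α] {f g : α → ℂ} (hf : Measurable f)
    (hg : Measurable g) : Measurable fun x => shiftDensity (f x) (g x) := by
  unfold shiftDensity
  have : Measurable fun x => star (f x) := continuous_star.measurable.comp hf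
  have := Complex.measurable_re.comp (hg.mul this)
  exact (Real.measurable_exp.comp ((this.const_mul 2).sub (hf.norm.pow_const 2))).ennreal_ofReal

lemma norm_sub_sq_complex (z c : ℂ) : ‖z - c‖ ^ 2 = ‖z‖ ^ 2 - 2 * (z * star c).re + ‖c‖ ^ 2 := by
  simp only [← Complex.normSq_eq_norm_sq, Complex.normSq_sub]
  simp
  ring

lemma complexGaussian_map_add (c : ℂ) :
    complexGaussian.map (fun z => c + z) = complexGaussian.withDensity (shiftDensity c) := by
  refine Measure.ext_of_lintegral _ fun φ hφ => ?_
  have hs : Measurable (shiftDensity c) := measurable_shiftDensity measurable_const measurable_id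
  rw [lintegral_map hφ (by fun_prop), lintegral_withDensity_eq_lintegral_mul _ hs hφ,
    complexGaussian_eq_withDensity,
    lintegral_withDensity_eq_lintegral_mul _ (by fun_prop) (by fun_prop),
    lintegral_withDensity_eq_lintegral_mul _ (by fun_prop) (hs.mul hφ),
    ← lintegral_sub_right_eq_self _ c]
  refine lintegral_congr fun z => ?_
  simp only [Pi.mul_apply, add_sub_cancel]
  rw [← mul_assoc]
  congr 1
  rw [shiftDensity, ← ENNReal.ofReal_mul (by positivity), mul_assoc, ← Real.exp_add,
    norm_sub_sq_complex]
  congr 3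
  ring

lemma lintegral_exp_neg_mul_normSq {s : ℝ} (hs : 0 < s) :
    ∫⁻ z : ℂ, ENNReal.ofReal (Real.exp (-s * ‖z‖ ^ 2)) = ENNReal.ofReal (Real.pi / s) := by
  have h := GaussianFourier.integral_rexp_neg_mul_sq_norm (V := ℂ) hs
  have h' : ∫ z : ℂ, Real.exp (-s * ‖z‖ ^ 2) = Real.pi / s := by
    rw [h]; simp
  rw [← h', ofReal_integral_eq_lintegral_ofReal _ (ae_of_all _ fun _ => (Real.exp_pos _).le)]
  -- A non-integrable function has Bochner integral `0` by convention, which contradicts the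
  -- positive value `π / s`.
  by_contra hni
  rw [integral_undef hni] at h'
  exact (div_pos Real.pi_pos hs).ne h'

/-- Completing the square in `h` leaves a Gaussian of precision `1 + a` centred at `√a w / (1 + a)`.
Its normalization supplies the term `-log (1 + a)`, and the square of the centre the coefficient `a
/ (1 + a)`. -/
lemma lintegral_shift_complexGaussian (a : ℝ≥0) (w : ℂ) :
    ∫⁻ h, ENNReal.ofReal (Real.exp (2 * (w * star h).re * Real.sqrt a - a * ‖h‖ ^ 2))
        ∂complexGaussian =
      ENNReal.ofReal (Real.exp (-Real.log (1 + a) + a / (1 + a) * ‖w‖ ^ 2)) := by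
  have ha : (0 : ℝ) < 1 + a := by positivity
  set c : ℂ := ((Real.sqrt a / (1 + a) : ℝ) : ℂ) * w with hc
  rw [complexGaussian_eq_withDensity,
    lintegral_withDensity_eq_lintegral_mul _ (by fun_prop) (by fun_prop)]
  have hpt : ∀ h : ℂ, ENNReal.ofReal (Real.pi⁻¹ * Real.exp (-‖h‖ ^ 2)) *
      ENNReal.ofReal (Real.exp (2 * (w * star h).re * Real.sqrt a - a * ‖h‖ ^ 2)) =
      ENNReal.ofReal (Real.pi⁻¹ * Real.exp (a / (1 + a) * ‖w‖ ^ 2)) *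
        ENNReal.ofReal (Real.exp (-(1 + a) * ‖h - c‖ ^ 2)) := by
    intro h
    rw [← ENNReal.ofReal_mul (by positivity), ← ENNReal.ofReal_mul (by positivity),
      mul_assoc Real.pi⁻¹, mul_assoc Real.pi⁻¹, ← Real.exp_add, ← Real.exp_add, norm_sub_sq_complex]
    congr 3
    have h1 : (h * star c).re = Real.sqrt a / (1 + a) * (w * star h).re := by
      rw [hc]
      generalize Real.sqrt a / (1 + a) = s
      simp
      ring
    have h2 : ‖c‖ ^ 2 = a / (1 + a) ^ 2 * ‖w‖ ^ 2 := by
      rw [hc, norm_mul, mul_pow, Complex.norm_real, Real.norm_eq_abs, sq_abs, div_pow,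
        Real.sq_sqrt a.coe_nonneg]
    rw [h1, h2]
    field_simp
    ring
  simp only [Pi.mul_apply, hpt]
  rw [lintegral_const_mul _ (by fun_prop),
    lintegral_sub_right_eq_self (fun h : ℂ => ENNReal.ofReal (Real.exp (-(1 + a) * ‖h‖ ^ 2))) c,
    lintegral_exp_neg_mul_normSq ha, ← ENNReal.ofReal_mul (by positivity), Real.exp_add,
    Real.exp_neg, Real.exp_log ha]
  congr 1
  field_simp

end Gaussian

/-! ### The output law as a density relative to the noise -/

section Channel

variable {N L : ℕ}

/-- The law of the noise matrix `Z`. -/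
abbrev noiseLaw (N L : ℕ) : Measure (Fin N → Fin L → ℂ) :=
  Measure.pi fun _ : Fin N => Measure.pi fun _ : Fin L => complexGaussian

/-- The law of the fading vector `h`. -/
abbrev fadingLaw (N : ℕ) : Measure (Fin N → ℂ) :=
  Measure.pi fun _ : Fin N => complexGaussian

/-- The correlation of a row of the output with the direction `u`. -/
def rowProj (u : UnitVec L) (y : Fin L → ℂ) : ℂ := ∑ l, y l * u.1 l

/-- The logarithm of the density of the output given `u`, relative to the law of the noise. -/
def logDensity (a : ℝ≥0) (u : UnitVec L) (y : Fin N → Fin L → ℂ) : ℝ :=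
  -(N * Real.log (1 + a)) + a / (1 + a) * ∑ n, ‖rowProj u (y n)‖ ^ 2

lemma sum_norm_sq_unitVec (u : UnitVec L) : ∑ l, ‖u.1 l‖ ^ 2 = 1 := by
  have h : ‖u.1‖ = 1 := by simp
  rw [← EuclideanSpace.norm_sq_eq, h, one_pow]

lemma continuous_logDensity (a : ℝ≥0) :
    Continuous fun p : UnitVec L × (Fin N → Fin L → ℂ) => logDensity a p.1 p.2 := by
  unfold logDensity rowProj
  fun_prop

lemma measurable_logDensity (a : ℝ≥0) :
    Measurable (Function.uncurry (logDensity (N := N) (L := L) a)) :=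
  (continuous_logDensity a).measurable

lemma norm_rowProj_sq_le (u : UnitVec L) (y : Fin L → ℂ) :
    ‖rowProj u y‖ ^ 2 ≤ ∑ l, ‖y l‖ ^ 2 := by
  calc ‖rowProj u y‖ ^ 2 ≤ (∑ l, ‖y l‖ * ‖u.1 l‖) ^ 2 := by
        gcongr
        refine (norm_sum_le _ _).trans_eq (by simp)
    _ ≤ (∑ l, ‖y l‖ ^ 2) * ∑ l, ‖u.1 l‖ ^ 2 := Finset.sum_mul_sq_le_sq_mul_sq _ _ _
    _ = _ := by rw [sum_norm_sq_unitVec, mul_one]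

lemma noiseLaw_map_add (V : Fin N → Fin L → ℂ) :
    (noiseLaw N L).map (fun Z n l => V n l + Z n l) =
      (noiseLaw N L).withDensity fun y => ∏ n, ∏ l, shiftDensity (V n l) (y n l) := by
  have hm : ∀ c, Measurable (shiftDensity c) := fun c =>
    measurable_shiftDensity measurable_const measurable_id
  have hp : ∀ c, IsProbabilityMeasure (complexGaussian.withDensity (shiftDensity c)) := by
    intro c
    rw [← complexGaussian_map_add]
    exact Measure.isProbabilityMeasure_map (by fun_prop)
  have hp' : ∀ c : ℂ, IsProbabilityMeasure (complexGaussian.map fun z => c + z) := fun c =>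
    Measure.isProbabilityMeasure_map (by fun_prop)
  have hrow : ∀ v : Fin L → ℂ,
      (Measure.pi fun _ : Fin L => complexGaussian).map (fun z l => v l + z l) =
        (Measure.pi fun _ : Fin L => complexGaussian).withDensity
          fun y => ∏ l, shiftDensity (v l) (y l) := by
    intro v
    rw [Measure.pi_map_pi (f := fun l z => v l + z) (fun l => by fun_prop)]
    simp_rw [complexGaussian_map_add]
    exact pi_withDensity fun l => hm _
  have hadd : ∀ v : Fin L → ℂ, Measurable fun (z : Fin L → ℂ) l => v l + z l := fun v => by
    fun_prop
  have hpr : ∀ v : Fin L → ℂ, IsProbabilityMeasure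
      ((Measure.pi fun _ : Fin L => complexGaussian).map (fun z l => v l + z l)) := fun v =>
    Measure.isProbabilityMeasure_map (hadd v).aemeasurable
  have hpr' : ∀ v : Fin L → ℂ, IsProbabilityMeasure
      ((Measure.pi fun _ : Fin L => complexGaussian).withDensity
          fun y => ∏ l, shiftDensity (v l) (y l)) := fun v => by
    rw [← hrow]; infer_instance
  rw [noiseLaw, Measure.pi_map_pi (f := fun n (z : Fin L → ℂ) l => V n l + z l)
    (fun n => (hadd _).aemeasurable)]
  simp_rw [hrow]
  exact pi_withDensity fun n => Finset.measurable_fun_prod _ fun l _ =>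
    (hm _).comp (measurable_pi_apply l)

/-- The density of the output given `u` and `h`, relative to the law of the noise. -/
def signalDensity (a : ℝ≥0) (u : UnitVec L) (h : Fin N → ℂ) (y : Fin N → Fin L → ℂ) : ℝ≥0∞ :=
  ∏ n, ∏ l, shiftDensity (h n * star ((Real.sqrt a : ℂ) * u.1 l)) (y n l)

lemma measurable_signalDensity (a : ℝ≥0) (u : UnitVec L) :
    Measurable (Function.uncurry (signalDensity (N := N) a u)) := by
  unfold Function.uncurry signalDensity
  refine Finset.measurable_fun_prod _ fun n _ => Finset.measurable_fun_prod _ fun l _ => ?_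
  fun_prop

/-- Since `u` has norm one, the shift densities of a row combine into an expression in `rowProj u (y
n)` and `h n` alone. The rows are independent, so each fading coefficient integrates out separately.
-/
lemma lintegral_signalDensity (a : ℝ≥0) (u : UnitVec L) (y : Fin N → Fin L → ℂ) :
    ∫⁻ h, signalDensity a u h y ∂fadingLaw N = ENNReal.ofReal (Real.exp (logDensity a u y)) := by
  have hrow : ∀ (n : Fin N) (h : ℂ),
      ∏ l, shiftDensity (h * star ((Real.sqrt a : ℂ) * u.1 l)) (y n l) =
      ENNReal.ofReal (Real.exp (2 * (rowProj u (y n) * star h).re * Real.sqrt a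
        - a * ‖h‖ ^ 2)) := by
    intro n h
    unfold shiftDensity
    rw [← ENNReal.ofReal_prod_of_nonneg fun _ _ => (Real.exp_pos _).le, ← Real.exp_sum,
      Finset.sum_sub_distrib, ← Finset.mul_sum, ← Complex.re_sum]
    congr 3
    · have : ∑ l, y n l * star (h * star ((Real.sqrt a : ℂ) * u.1 l)) =
          (rowProj u (y n) * star h) * (Real.sqrt a : ℝ) := by
        rw [rowProj, Finset.sum_mul, Finset.sum_mul]
        refine Finset.sum_congr rfl fun l _ => ?_
        simp
        ring
      rw [this, Complex.re_mul_ofReal]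
      ring
    · have : ∀ l, ‖h * star ((Real.sqrt a : ℂ) * u.1 l)‖ ^ 2 = a * ‖h‖ ^ 2 * ‖u.1 l‖ ^ 2 := by
        intro l
        rw [norm_mul, norm_star, norm_mul, Complex.norm_real, Real.norm_eq_abs, mul_pow, mul_pow,
          sq_abs, Real.sq_sqrt a.coe_nonneg]
        ring
      simp_rw [this]
      rw [← Finset.mul_sum, sum_norm_sq_unitVec, mul_one]
  simp_rw [signalDensity, hrow]
  rw [lintegral_pi_prod (f := fun n h => ENNReal.ofReal (Real.exp
    (2 * (rowProj u (y n) * star h).re * Real.sqrt a - a * ‖h‖ ^ 2))) (fun n => by fun_prop)]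
  simp_rw [lintegral_shift_complexGaussian]
  rw [← ENNReal.ofReal_prod_of_nonneg fun _ _ => (Real.exp_pos _).le, ← Real.exp_sum, logDensity,
    Finset.sum_add_distrib, Finset.mul_sum]
  simp

lemma measurable_channelOutput (a : ℝ≥0) :
    Measurable fun w : UnitVec L × ((Fin N → ℂ) × (Fin N → Fin L → ℂ)) =>
      channelOutput a w.1 w.2.1 w.2.2 := by
  unfold channelOutput
  fun_prop

lemma lintegral_noise_channelOutput (a : ℝ≥0) (u : UnitVec L) (h : Fin N → ℂ)
    {φ : (Fin N → Fin L → ℂ) → ℝ≥0∞} (hφ : Measurable φ) :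
    ∫⁻ Z, φ (channelOutput a u h Z) ∂noiseLaw N L =
      ∫⁻ y, signalDensity a u h y * φ y ∂noiseLaw N L := by
  have hadd : Measurable fun (Z : Fin N → Fin L → ℂ) n l =>
      h n * star ((Real.sqrt a : ℂ) * u.1 l) + Z n l := by fun_prop
  calc ∫⁻ Z, φ (channelOutput a u h Z) ∂noiseLaw N L
      = ∫⁻ y, φ y ∂(noiseLaw N L).map fun Z n l =>
          h n * star ((Real.sqrt a : ℂ) * u.1 l) + Z n l := (lintegral_map hφ hadd).symm
    _ = ∫⁻ y, φ y ∂(noiseLaw N L).withDensity (signalDensity a u h) := by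
        rw [noiseLaw_map_add]; rfl
    _ = _ := lintegral_withDensity_eq_lintegral_mul _
        ((measurable_signalDensity a u).of_uncurry_left) hφ

lemma lintegral_channelOutput (a : ℝ≥0) (u : UnitVec L) {φ : (Fin N → Fin L → ℂ) → ℝ≥0∞}
    (hφ : Measurable φ) :
    ∫⁻ h, ∫⁻ Z, φ (channelOutput a u h Z) ∂noiseLaw N L ∂fadingLaw N =
      ∫⁻ y, ENNReal.ofReal (Real.exp (logDensity a u y)) * φ y ∂noiseLaw N L := by
  have hm := measurable_signalDensity (N := N) a u
  have hm2 : Measurable fun p : (Fin N → ℂ) × (Fin N → Fin L → ℂ) =>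
      signalDensity a u p.1 p.2 * φ p.2 := hm.mul (hφ.comp measurable_snd)
  simp_rw [lintegral_noise_channelOutput a u _ hφ]
  rw [lintegral_lintegral_swap hm2.aemeasurable]
  refine lintegral_congr fun y => ?_
  rw [lintegral_mul_const _ hm.of_uncurry_right, lintegral_signalDensity]

lemma map_channelOutput (a : ℝ≥0) (u : UnitVec L) :
    ((fadingLaw N).prod (noiseLaw N L)).map (fun w => channelOutput a u w.1 w.2) =
      (noiseLaw N L).withDensity fun y => ENNReal.ofReal (Real.exp (logDensity a u y)) := by
  have hc : Measurable fun w : (Fin N → ℂ) × (Fin N → Fin L → ℂ) => channelOutput a u w.1 w.2 :=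
    (measurable_channelOutput a).comp measurable_prodMk_left
  have hd : Measurable fun y : Fin N → Fin L → ℂ => logDensity a u y :=
    (measurable_logDensity a).of_uncurry_left
  refine Measure.ext_of_lintegral _ fun φ hφ => ?_
  rw [lintegral_map hφ hc, lintegral_prod _ (by fun_prop), lintegral_channelOutput a u hφ,
    lintegral_withDensity_eq_lintegral_mul _ (by fun_prop) hφ]
  rfl

lemma lintegral_exp_logDensity (a : ℝ≥0) (u : UnitVec L) :
    ∫⁻ y, ENNReal.ofReal (Real.exp (logDensity a u y)) ∂noiseLaw N L = 1 := by
  -- Testing against the constant `1` shows that the density has total mass one.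
  have := lintegral_channelOutput (N := N) a u (φ := fun _ => 1) measurable_const
  simpa using this.symm

instance [NeZero L] : IsProbabilityMeasure (isotropic L) := by
  constructor
  have h0 : (volume : Measure (EuclideanSpace ℂ (Fin L))).toSphere ≠ 0 :=
    Measure.toSphere_ne_zero _
  rw [isotropic, Measure.smul_apply, smul_eq_mul, ENNReal.inv_mul_cancel]
  · exact fun h => h0 (Measure.measure_univ_eq_zero.1 h)
  · exact measure_ne_top _ _

lemma shapeOutputLaw_eq (a : ℝ≥0) :
    shapeOutputLaw N L a = expDensity (isotropic L) (noiseLaw N L) (logDensity a) := by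
  have hm := measurable_ofReal_exp (measurable_logDensity (N := N) (L := L) a)
  have hc := measurable_channelOutput (N := N) (L := L) a
  refine Measure.ext_of_lintegral _ fun φ hφ => ?_
  rw [shapeOutputLaw, lintegral_map hφ (by fun_prop), lintegral_prod _ (by fun_prop), expDensity,
    lintegral_withDensity_eq_lintegral_mul _ hm hφ, lintegral_prod _ (by fun_prop)]
  refine lintegral_congr fun u => ?_
  rw [lintegral_prod _ (by fun_prop)]
  exact lintegral_channelOutput a u (φ := fun y => φ (u, y)) (by fun_prop)

end Channel

/-! ### Second moments of linear forms in Gaussian variables -/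

section Moments

lemma integrable_sq_gaussianReal (v : ℝ≥0) : Integrable (fun x => x ^ 2) (gaussianReal 0 v) :=
  (memLp_id_gaussianReal (μ := 0) (v := v) 2).integrable_sq

lemma integral_sq_gaussianReal (v : ℝ≥0) : ∫ x, x ^ 2 ∂gaussianReal 0 v = v := by
  have h := variance_of_integral_eq_zero (μ := gaussianReal 0 v) (X := fun x => x)
    (by fun_prop) integral_id_gaussianReal
  rw [variance_fun_id_gaussianReal] at h
  exact h.symm

lemma norm_sq_measurableEquivRealProd_symm (p : ℝ × ℝ) :
    ‖Complex.measurableEquivRealProd.symm p‖ ^ 2 = p.1 ^ 2 + p.2 ^ 2 := by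
  rw [Complex.measurableEquivRealProd_symm_apply, ← Complex.normSq_eq_norm_sq, Complex.normSq_mk]
  ring

lemma integrable_norm_sq_complexGaussian : Integrable (fun z => ‖z‖ ^ 2) complexGaussian := by
  rw [complexGaussian, integrable_map_equiv]
  have h := integrable_sq_gaussianReal (1 / 2)
  refine ((h.comp_fst (gaussianReal 0 (1 / 2))).add (h.comp_snd (gaussianReal 0 (1 / 2)))).congr
    (ae_of_all _ fun p => ?_)
  exact (norm_sq_measurableEquivRealProd_symm p).symm

lemma integral_norm_sq_complexGaussian : ∫ z, ‖z‖ ^ 2 ∂complexGaussian = 1 := by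
  have h := integrable_sq_gaussianReal (1 / 2)
  rw [complexGaussian, integral_map_equiv]
  simp_rw [norm_sq_measurableEquivRealProd_symm]
  rw [integral_add (h.comp_fst _) (h.comp_snd _), integral_fun_fst (fun x : ℝ => x ^ 2),
    integral_fun_snd (fun x : ℝ => x ^ 2), integral_sq_gaussianReal]
  simp
  norm_num

lemma memLp_complexGaussian : MemLp (fun z : ℂ => z) 2 complexGaussian :=
  (memLp_two_iff_integrable_sq_norm (by fun_prop)).2 integrable_norm_sq_complexGaussian

/-- The density depends only on `‖z‖`, so the reflection `z ↦ -z` equates the mean with its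
negative. -/
lemma integral_complexGaussian : ∫ z, z ∂complexGaussian = 0 := by
  have hneg : ∫ z, z ∂complexGaussian = -∫ z, z ∂complexGaussian := by
    rw [← integral_neg, complexGaussian_eq_withDensity,
      integral_withDensity_eq_integral_toReal_smul (by fun_prop) (ae_of_all _ fun _ => by simp),
      integral_withDensity_eq_integral_toReal_smul (by fun_prop) (ae_of_all _ fun _ => by simp),
      ← integral_neg_eq_self]
    simp
  exact self_eq_neg.1 hneg

variable {L : ℕ}

/-- The second moment of a linear form in independent standard complex Gaussians. -/
lemma integral_norm_sq_linear (v : Fin L → ℂ) :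
    ∫ z, ‖∑ l, z l * v l‖ ^ 2 ∂(Measure.pi fun _ : Fin L => complexGaussian) =
      ∑ l, ‖v l‖ ^ 2 := by
  have hm : ∀ c : ℂ, MemLp (fun z : ℂ => z * c) 2 complexGaussian := fun c => by
    simpa [mul_comm] using memLp_complexGaussian.const_mul c
  have hre : ∀ c : ℂ, MemLp (fun z : ℂ => (z * c).re) 2 complexGaussian := fun c => (hm c).re
  have him : ∀ c : ℂ, MemLp (fun z : ℂ => (z * c).im) 2 complexGaussian := fun c => (hm c).im
  have hmean : ∀ c : ℂ, ∫ z, z * c ∂complexGaussian = 0 := fun c => by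
    rw [integral_mul_const, integral_complexGaussian, zero_mul]
  have hmre : ∀ c : ℂ, ∫ z, (z * c).re ∂complexGaussian = 0 := fun c => by
    have := integral_re ((hm c).integrable (by norm_num))
    rw [hmean] at this
    simpa using this
  have hmim : ∀ c : ℂ, ∫ z, (z * c).im ∂complexGaussian = 0 := fun c => by
    have := integral_im ((hm c).integrable (by norm_num))
    rw [hmean] at this
    simpa using this
  -- For centred real variables the second moment is the variance, and variances of independent
  -- variables add. This is applied to real and imaginary parts separately.
  have hsum : ∀ f : Fin L → ℂ → ℝ, (∀ l, MemLp (f l) 2 complexGaussian) →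
      (∀ l, ∫ z, f l z ∂complexGaussian = 0) →
      Integrable (fun z : Fin L → ℂ => (∑ l, f l (z l)) ^ 2)
        (Measure.pi fun _ : Fin L => complexGaussian) ∧
      ∫ z, (∑ l, f l (z l)) ^ 2 ∂(Measure.pi fun _ : Fin L => complexGaussian) =
        ∑ l, ∫ z, f l z ^ 2 ∂complexGaussian := by
    intro f hf h0
    have hfl : ∀ l, MemLp (fun z : Fin L → ℂ => f l (z l)) 2
        (Measure.pi fun _ : Fin L => complexGaussian) := fun l =>
      (hf l).comp_measurePreserving (measurePreserving_eval _ l)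
    have hS : MemLp (fun z : Fin L → ℂ => ∑ l, f l (z l)) 2
        (Measure.pi fun _ : Fin L => complexGaussian) := memLp_finsetSum _ fun l _ => hfl l
    refine ⟨hS.integrable_sq, ?_⟩
    have hz : ∫ z, (∑ l, f l (z l)) ∂(Measure.pi fun _ : Fin L => complexGaussian) = 0 := by
      rw [integral_finsetSum _ fun l _ => (hfl l).integrable (by norm_num)]
      refine Finset.sum_eq_zero fun l _ => ?_
      rw [← h0 l]
      exact integral_comp_eval (hf l).1
    rw [← variance_of_integral_eq_zero hS.1.aemeasurable hz]
    have := variance_sum_pi (μ := fun _ : Fin L => complexGaussian) (X := f) hf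
    rw [show (fun z : Fin L → ℂ => ∑ l, f l (z l)) = ∑ l, fun z : Fin L → ℂ => f l (z l) by
      ext; simp, this]
    exact Finset.sum_congr rfl fun l _ =>
      variance_of_integral_eq_zero (hf l).1.aemeasurable (h0 l)
  obtain ⟨i1, e1⟩ := hsum (fun l z => (z * v l).re) (fun l => hre _) fun l => hmre _
  obtain ⟨i2, e2⟩ := hsum (fun l z => (z * v l).im) (fun l => him _) fun l => hmim _
  have hns : ∀ z : ℂ, ‖z‖ ^ 2 = z.re ^ 2 + z.im ^ 2 := fun z => by
    rw [← Complex.normSq_eq_norm_sq, Complex.normSq_apply]; ring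
  simp_rw [hns, Complex.re_sum, Complex.im_sum]
  rw [integral_add i1 i2, e1, e2, ← Finset.sum_add_distrib]
  refine Finset.sum_congr rfl fun l _ => ?_
  rw [← integral_add (hre _).integrable_sq (him _).integrable_sq]
  simp_rw [← hns, norm_mul, mul_pow]
  rw [integral_mul_const, integral_norm_sq_complexGaussian, one_mul]

lemma memLp_linear (v : Fin L → ℂ) :
    MemLp (fun z : Fin L → ℂ => ∑ l, z l * v l) 2
      (Measure.pi fun _ : Fin L => complexGaussian) := by
  refine memLp_finsetSum _ fun l _ => ?_
  have : MemLp (fun z : ℂ => z * v l) 2 complexGaussian := by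
    simpa [mul_comm] using memLp_complexGaussian.const_mul (v l)
  exact this.comp_measurePreserving (measurePreserving_eval _ l)

/-- A projected output row has this form: a fading term plus projected noise. The cross term
vanishes because the two are independent and the fading is centred. -/
lemma integral_norm_sq_affine (α : ℂ) (v : Fin L → ℂ) :
    Integrable (fun p : ℂ × (Fin L → ℂ) => ‖p.1 * α + ∑ l, p.2 l * v l‖ ^ 2)
        (complexGaussian.prod (Measure.pi fun _ : Fin L => complexGaussian)) ∧
    ∫ p : ℂ × (Fin L → ℂ), ‖p.1 * α + ∑ l, p.2 l * v l‖ ^ 2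
        ∂(complexGaussian.prod (Measure.pi fun _ : Fin L => complexGaussian)) =
      ‖α‖ ^ 2 + ∑ l, ‖v l‖ ^ 2 := by
  set γ := Measure.pi fun _ : Fin L => complexGaussian
  have hA : MemLp (fun z : ℂ => z * α) 2 complexGaussian := by
    simpa [mul_comm] using memLp_complexGaussian.const_mul α
  have hB := memLp_linear v
  have hA' : MemLp (fun p : ℂ × (Fin L → ℂ) => p.1 * α) 2 (complexGaussian.prod γ) :=
    hA.comp_measurePreserving measurePreserving_fst
  have hB' : MemLp (fun p : ℂ × (Fin L → ℂ) => ∑ l, p.2 l * v l) 2 (complexGaussian.prod γ) :=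
    hB.comp_measurePreserving measurePreserving_snd
  refine ⟨(hA'.add hB').integrable_norm_pow (by norm_num), ?_⟩
  have hexp : ∀ p : ℂ × (Fin L → ℂ), ‖p.1 * α + ∑ l, p.2 l * v l‖ ^ 2 =
      (‖p.1 * α‖ ^ 2 + ‖∑ l, p.2 l * v l‖ ^ 2) +
        2 * (p.1 * α * star (∑ l, p.2 l * v l)).re := by
    intro p
    rw [← sub_neg_eq_add (p.1 * α), norm_sub_sq_complex]
    simp
    ring
  have i1 : Integrable (fun p : ℂ × (Fin L → ℂ) => ‖p.1 * α‖ ^ 2) (complexGaussian.prod γ) :=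
    hA'.integrable_norm_pow (by norm_num)
  have i2 : Integrable (fun p : ℂ × (Fin L → ℂ) => ‖∑ l, p.2 l * v l‖ ^ 2)
      (complexGaussian.prod γ) := hB'.integrable_norm_pow (by norm_num)
  have hBs : MemLp (fun z : Fin L → ℂ => star (∑ l, z l * v l)) 2 γ := hB.star
  have i3 : Integrable (fun p : ℂ × (Fin L → ℂ) => p.1 * α * star (∑ l, p.2 l * v l))
      (complexGaussian.prod γ) :=
    (hA.integrable (by norm_num)).mul_prod (hBs.integrable (by norm_num))
  have hcross : ∫ p : ℂ × (Fin L → ℂ), (p.1 * α * star (∑ l, p.2 l * v l)).re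
      ∂(complexGaussian.prod γ) = 0 := by
    have h := integral_re i3
    rw [integral_prod_mul (fun z : ℂ => z * α) (fun z : Fin L → ℂ => star (∑ l, z l * v l)),
      integral_mul_const, integral_complexGaussian] at h
    simpa using h
  simp_rw [hexp]
  have i4 : Integrable (fun p : ℂ × (Fin L → ℂ) => 2 * (p.1 * α * star (∑ l, p.2 l * v l)).re)
      (complexGaussian.prod γ) := i3.re.const_mul 2
  have i5 : Integrable (fun p : ℂ × (Fin L → ℂ) => ‖p.1 * α‖ ^ 2 + ‖∑ l, p.2 l * v l‖ ^ 2)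
      (complexGaussian.prod γ) := i1.add i2
  rw [integral_add i5 i4, integral_add i1 i2, integral_const_mul, hcross,
    integral_fun_fst (fun z : ℂ => ‖z * α‖ ^ 2),
    integral_fun_snd (fun z : Fin L → ℂ => ‖∑ l, z l * v l‖ ^ 2), integral_norm_sq_linear]
  simp_rw [norm_mul, mul_pow]
  rw [integral_mul_const, integral_norm_sq_complexGaussian]
  simp

end Moments

/-! ### Divergence between directions, cap masses, and the localized bound -/

section InfoBound

variable {N L : ℕ}

/-- This supplies the envelope `b`: Cauchy–Schwarz on each row removes the dependence on `u`. -/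
lemma abs_logDensity_le (a : ℝ≥0) (u : UnitVec L) (y : Fin N → Fin L → ℂ) :
    |logDensity a u y| ≤ N * Real.log (1 + a) + ∑ n, ∑ l, ‖y n l‖ ^ 2 := by
  have h0 : 0 ≤ N * Real.log (1 + (a : ℝ)) :=
    mul_nonneg (Nat.cast_nonneg _) (Real.log_nonneg (by simp))
  have h1 : 0 ≤ ∑ n, ‖rowProj u (y n)‖ ^ 2 := by positivity
  have h2 : ∑ n, ‖rowProj u (y n)‖ ^ 2 ≤ ∑ n, ∑ l, ‖y n l‖ ^ 2 :=
    Finset.sum_le_sum fun n _ => norm_rowProj_sq_le u (y n)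
  have h3 : (a : ℝ) / (1 + a) ≤ 1 := by
    rw [div_le_one (by positivity)]; simp
  have h4 : (0 : ℝ) ≤ a / (1 + a) := by positivity
  have h5 := mul_le_mul h3 le_rfl h1 zero_le_one
  have h6 := mul_nonneg h4 h1
  rw [logDensity, abs_le]
  constructor <;> linarith

lemma norm_channelOutput_sq_le (a : ℝ≥0) (u : UnitVec L) (h : Fin N → ℂ) (Z : Fin N → Fin L → ℂ)
    (n : Fin N) (l : Fin L) :
    ‖channelOutput a u h Z n l‖ ^ 2 ≤ 2 * (a * ‖h n‖ ^ 2) + 2 * ‖Z n l‖ ^ 2 := by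
  have hu : ‖u.1 l‖ ^ 2 ≤ 1 := by
    have h := Finset.single_le_sum (f := fun l => ‖u.1 l‖ ^ 2) (fun _ _ => by positivity)
      (Finset.mem_univ l)
    rwa [sum_norm_sq_unitVec] at h
  have hs : ‖h n * star ((Real.sqrt a : ℂ) * u.1 l)‖ ^ 2 ≤ a * ‖h n‖ ^ 2 := by
    rw [norm_mul, norm_star, norm_mul, Complex.norm_real, Real.norm_eq_abs, mul_pow, mul_pow,
      sq_abs, Real.sq_sqrt a.coe_nonneg]
    have : 0 ≤ (a : ℝ) * ‖h n‖ ^ 2 := by positivity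
    nlinarith
  have ht := norm_add_le (h n * star ((Real.sqrt a : ℂ) * u.1 l)) (Z n l)
  unfold channelOutput
  have := pow_le_pow_left₀ (norm_nonneg _) ht 2
  nlinarith [sq_nonneg (‖h n * star ((Real.sqrt a : ℂ) * u.1 l)‖ - ‖Z n l‖)]

lemma integrable_fading_noise (a : ℝ≥0) (K : ℝ) :
    Integrable (fun w : (Fin N → ℂ) × (Fin N → Fin L → ℂ) =>
      K + ∑ n, ∑ l, (2 * (a * ‖w.1 n‖ ^ 2) + 2 * ‖w.2 n l‖ ^ 2))
      ((fadingLaw N).prod (noiseLaw N L)) := by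
  refine (integrable_const _).add (integrable_finsetSum _ fun n _ => integrable_finsetSum _
    fun l _ => Integrable.add ?_ ?_)
  · have h : Integrable (fun h : Fin N → ℂ => ‖h n‖ ^ 2) (fadingLaw N) :=
      (measurePreserving_eval (fun _ : Fin N => complexGaussian) n).integrable_comp_of_integrable
        integrable_norm_sq_complexGaussian
    exact ((h.comp_fst _).const_mul _).const_mul _
  · have h1 : Integrable (fun z : Fin L → ℂ => ‖z l‖ ^ 2)
        (Measure.pi fun _ : Fin L => complexGaussian) :=
      (measurePreserving_eval (fun _ : Fin L => complexGaussian) l).integrable_comp_of_integrable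
        integrable_norm_sq_complexGaussian
    have h2 : Integrable (fun Z : Fin N → Fin L → ℂ => ‖Z n l‖ ^ 2) (noiseLaw N L) :=
      (measurePreserving_eval (fun _ : Fin N => Measure.pi fun _ : Fin L => complexGaussian)
        n).integrable_comp_of_integrable h1
    exact (h2.comp_snd _).const_mul _

lemma norm_bound_channelOutput (a : ℝ≥0) {K : ℝ} (hK : 0 ≤ K) (u : UnitVec L) (h : Fin N → ℂ)
    (Z : Fin N → Fin L → ℂ) :
    ‖K + ∑ n, ∑ l, ‖channelOutput a u h Z n l‖ ^ 2‖ ≤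
      K + ∑ n, ∑ l, (2 * (a * ‖h n‖ ^ 2) + 2 * ‖Z n l‖ ^ 2) := by
  rw [Real.norm_of_nonneg (by positivity)]
  gcongr with n _ l _
  exact norm_channelOutput_sq_le a u h Z n l

lemma integrable_conditional (a : ℝ≥0) {K : ℝ} (hK : 0 ≤ K) (u : UnitVec L) :
    Integrable (fun y : Fin N → Fin L → ℂ => K + ∑ n, ∑ l, ‖y n l‖ ^ 2)
      ((noiseLaw N L).withDensity fun y => ENNReal.ofReal (Real.exp (logDensity a u y))) := by
  have hc : Measurable fun w : (Fin N → ℂ) × (Fin N → Fin L → ℂ) => channelOutput a u w.1 w.2 :=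
    (measurable_channelOutput a).comp measurable_prodMk_left
  have hb : Measurable fun y : Fin N → Fin L → ℂ => K + ∑ n, ∑ l, ‖y n l‖ ^ 2 := by fun_prop
  rw [← map_channelOutput, integrable_map_measure hb.aestronglyMeasurable hc.aemeasurable]
  exact (integrable_fading_noise a K).mono' (hb.comp hc).aestronglyMeasurable
    (ae_of_all _ fun w => norm_bound_channelOutput a hK u w.1 w.2)

lemma integrable_joint [NeZero L] (a : ℝ≥0) {K : ℝ} (hK : 0 ≤ K) :
    Integrable (fun p : UnitVec L × (Fin N → Fin L → ℂ) => K + ∑ n, ∑ l, ‖p.2 n l‖ ^ 2)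
      (expDensity (isotropic L) (noiseLaw N L) (logDensity a)) := by
  have hc := measurable_channelOutput (N := N) (L := L) a
  have hb : Measurable fun p : UnitVec L × (Fin N → Fin L → ℂ) =>
    K + ∑ n, ∑ l, ‖p.2 n l‖ ^ 2 := by fun_prop
  have hc' := measurable_fst.prodMk hc
  rw [← shapeOutputLaw_eq, shapeOutputLaw,
    integrable_map_measure hb.aestronglyMeasurable hc'.aemeasurable]
  exact ((integrable_fading_noise a K).comp_snd (isotropic L)).mono'
    (hb.comp hc').aestronglyMeasurable
    (ae_of_all _ fun w => norm_bound_channelOutput a hK w.1 w.2.1 w.2.2)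

lemma rowProj_channelOutput (a : ℝ≥0) (u u' : UnitVec L) (h : Fin N → ℂ)
    (Z : Fin N → Fin L → ℂ) (n : Fin N) :
    rowProj u' (channelOutput a u h Z n) =
      h n * ((Real.sqrt a : ℂ) * inner ℂ u.1 u'.1) + ∑ l, Z n l * u'.1 l := by
  simp only [rowProj, channelOutput, PiLp.inner_apply, RCLike.inner_apply, add_mul,
    Finset.sum_add_distrib, Finset.mul_sum]
  congr 1
  refine Finset.sum_congr rfl fun l _ => ?_
  simp
  ring

lemma integral_rowProj (a : ℝ≥0) (u u' : UnitVec L) (n : Fin N) :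
    Integrable (fun y : Fin N → Fin L → ℂ => ‖rowProj u' (y n)‖ ^ 2)
      ((noiseLaw N L).withDensity fun y => ENNReal.ofReal (Real.exp (logDensity a u y))) ∧
    ∫ y, ‖rowProj u' (y n)‖ ^ 2
      ∂((noiseLaw N L).withDensity fun y => ENNReal.ofReal (Real.exp (logDensity a u y))) =
      a * ‖inner ℂ u.1 u'.1‖ ^ 2 + 1 := by
  have hc : Measurable fun w : (Fin N → ℂ) × (Fin N → Fin L → ℂ) => channelOutput a u w.1 w.2 :=
    (measurable_channelOutput a).comp measurable_prodMk_left
  have hb : Measurable fun y : Fin N → Fin L → ℂ => ‖rowProj u' (y n)‖ ^ 2 := by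
    unfold rowProj; fun_prop
  have hmp := (measurePreserving_eval (fun _ : Fin N => complexGaussian) n).prod
    (measurePreserving_eval (fun _ : Fin N => Measure.pi fun _ : Fin L => complexGaussian) n)
  obtain ⟨hi, he⟩ := integral_norm_sq_affine ((Real.sqrt a : ℂ) * inner ℂ u.1 u'.1)
    (fun l => u'.1 l)
  rw [← map_channelOutput, integrable_map_measure hb.aestronglyMeasurable hc.aemeasurable,
    integral_map hc.aemeasurable hb.aestronglyMeasurable]
  simp only [Function.comp_def, rowProj_channelOutput]
  refine ⟨hmp.integrable_comp_of_integrable hi, ?_⟩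
  have hnorm : ‖(Real.sqrt a : ℂ) * inner ℂ u.1 u'.1‖ ^ 2 = a * ‖inner ℂ u.1 u'.1‖ ^ 2 := by
    rw [norm_mul, Complex.norm_real, Real.norm_eq_abs, mul_pow, sq_abs,
      Real.sq_sqrt a.coe_nonneg]
  rw [sum_norm_sq_unitVec, hnorm] at he
  rw [← he, ← hmp.map_eq, integral_map hmp.measurable.aemeasurable]
  · rfl
  · rw [hmp.map_eq]; exact hi.aestronglyMeasurable

/-- With `t = |⟨u,u'⟩|`, the squared distance is at least `2 - 2t`, and `2 - 2t - (1 - t²) = (1 -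
t)²`. -/
lemma one_sub_norm_inner_sq_le (u u' : UnitVec L) :
    1 - ‖inner ℂ u.1 u'.1‖ ^ 2 ≤ dist u' u ^ 2 := by
  have hu : ‖u.1‖ = 1 := by simp
  have hu' : ‖u'.1‖ = 1 := by simp
  have h := norm_sub_sq (𝕜 := ℂ) u.1 u'.1
  rw [hu, hu'] at h
  have hre : RCLike.re (inner ℂ u.1 u'.1) ≤ ‖inner ℂ u.1 u'.1‖ := RCLike.re_le_norm _
  rw [dist_comm, Subtype.dist_eq, dist_eq_norm, h]
  nlinarith [sq_nonneg (1 - ‖inner ℂ u.1 u'.1‖)]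

/-- The divergence between the output laws given two directions. -/
lemma integral_logDensity_sub_le (a : ℝ≥0) (u u' : UnitVec L) :
    ∫ y, (logDensity a u y - logDensity a u' y)
      ∂((noiseLaw N L).withDensity fun y => ENNReal.ofReal (Real.exp (logDensity a u y))) ≤
      N * (a ^ 2 / (1 + a)) * dist u' u ^ 2 := by
  have hu : ‖inner ℂ u.1 u.1‖ = 1 := by
    have : ‖u.1‖ = 1 := by simp
    rw [inner_self_eq_norm_sq_to_K, this]
    simp
  have hdiff : ∀ y : Fin N → Fin L → ℂ, logDensity a u y - logDensity a u' y =
      a / (1 + a) * ∑ n, (‖rowProj u (y n)‖ ^ 2 - ‖rowProj u' (y n)‖ ^ 2) := by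
    intro y
    rw [Finset.sum_sub_distrib, logDensity, logDensity]
    ring
  simp_rw [hdiff]
  have hsub : ∀ n : Fin N, Integrable (fun y : Fin N → Fin L → ℂ =>
      ‖rowProj u (y n)‖ ^ 2 - ‖rowProj u' (y n)‖ ^ 2)
      ((noiseLaw N L).withDensity fun y => ENNReal.ofReal (Real.exp (logDensity a u y))) :=
    fun n => (integral_rowProj a u u n).1.sub (integral_rowProj a u u' n).1
  rw [integral_const_mul, integral_finsetSum _ fun n _ => hsub n]
  simp_rw [fun n => integral_sub (integral_rowProj (N := N) a u u n).1
    (integral_rowProj a u u' n).1, fun n => (integral_rowProj (N := N) a u u n).2,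
    fun n => (integral_rowProj (N := N) a u u' n).2]
  rw [hu, Finset.sum_const, Finset.card_univ, Fintype.card_fin, nsmul_eq_mul]
  calc (a : ℝ) / (1 + a) * (N * (a * 1 ^ 2 + 1 - (a * ‖inner ℂ u.1 u'.1‖ ^ 2 + 1)))
      = N * (a ^ 2 / (1 + a)) * (1 - ‖inner ℂ u.1 u'.1‖ ^ 2) := by ring
    _ ≤ _ := by
      gcongr
      exact one_sub_norm_inner_sq_le u u'

variable [NeZero L]

theorem mutualInfo_shapeOutputLaw_le_of_ball (a : ℝ≥0) {θ r : ℝ} (hθ : 0 < θ)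
    (hball : ∀ u, θ ≤ (isotropic L).real (Metric.ball u r)) :
    mutualInfo (shapeOutputLaw N L a) ≤
      ENNReal.ofReal (-Real.log θ + N * (a ^ 2 / (1 + a)) * r ^ 2) := by
  have hK : 0 ≤ N * Real.log (1 + (a : ℝ)) :=
    mul_nonneg (Nat.cast_nonneg _) (Real.log_nonneg (by simp))
  rw [shapeOutputLaw_eq]
  refine mutualInfo_expDensity_le (measurable_logDensity a) (abs_logDensity_le a)
    (lintegral_exp_logDensity a) (integrable_joint a hK) (integrable_conditional a hK)
    (fun u => Metric.isOpen_ball.measurableSet) hθ hball fun u u' hu' => ?_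
  refine (integral_logDensity_sub_le a u u').trans ?_
  gcongr
  exact (Metric.mem_ball.1 hu').le

/-- In real dimension `2 * L`, the surface measure of a cap is at least `2L (r/4)^(2L)` times the
volume of the unit ball, and the total surface measure is `2L` times that volume. -/
lemma isotropic_ball_ge {r : ℝ} (hr : 0 < r) (hr2 : r ≤ 2) (u : UnitVec L) :
    (r / 4) ^ (2 * L) ≤ (isotropic L).real (Metric.ball u r) := by
  set vol := (volume : Measure (EuclideanSpace ℂ (Fin L)))
  have h := vol.toSphereBallBound_mul_measureReal_unitBall_le_toSphere_ball hr u
  have hdim : Module.finrank ℝ (EuclideanSpace ℂ (Fin L)) = 2 * L := by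
    rw [finrank_real_of_complex]; simp
  have hu := vol.toSphere_real_apply_univ
  have hL : 2 * L ≠ 0 := by simp [NeZero.ne L]
  have hbd : (Measure.toSphereBallBound (2 * L) r : ℝ) = (2 * L : ℕ) * (r / 4) ^ (2 * L) := by
    unfold Measure.toSphereBallBound
    rw [if_pos ⟨hL, hr⟩]
    push_cast
    rw [Real.coe_toNNReal _ hr.le, min_eq_left hr2]
  have hpos : 0 < vol.real (Metric.ball 0 1) :=
    ENNReal.toReal_pos (Metric.measure_ball_pos _ _ one_pos).ne' measure_ball_lt_top.ne
  rw [hdim] at h hu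
  rw [hbd] at h
  have hLp : (0 : ℝ) < (2 * L : ℕ) := by exact_mod_cast Nat.pos_of_ne_zero hL
  have hiso : (isotropic L).real (Metric.ball u r) =
      (vol.toSphere.real Set.univ)⁻¹ * vol.toSphere.real (Metric.ball u r) := by
    simp [isotropic, measureReal_def, vol]
  rw [hiso, hu, ← div_eq_inv_mul, le_div_iff₀ (by positivity)]
  linarith

/-- Localizing to a cap of radius `r`. -/
theorem mutualInfo_shapeOutputLaw_le (a : ℝ≥0) {r : ℝ} (hr : 0 < r) (hr2 : r ≤ 2) :
    mutualInfo (shapeOutputLaw N L a) ≤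
      ENNReal.ofReal (L * Real.log (16 / r ^ 2) + N * (a ^ 2 / (1 + a)) * r ^ 2) := by
  have h := mutualInfo_shapeOutputLaw_le_of_ball (N := N) a (θ := (r / 4) ^ (2 * L)) (r := r)
    (by positivity) (isotropic_ball_ge hr hr2)
  convert h using 4
  rw [Real.log_pow, ← mul_neg, ← Real.log_inv, inv_div, show (16 : ℝ) / r ^ 2 = (4 / r) ^ 2 by
    rw [div_pow]; norm_num, Real.log_pow]
  push_cast
  ring

theorem mutualInfo_shapeOutputLaw_le_quadratic (a : ℝ≥0) :
    mutualInfo (shapeOutputLaw N L a) ≤ ENNReal.ofReal (N * (a ^ 2 / (1 + a)) * 9) := by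
  -- Radius `3` exceeds the diameter `2`, so the open ball is the whole sphere, `-log θ` vanishes,
  -- and `9 = 3²`.
  have h := mutualInfo_shapeOutputLaw_le_of_ball (N := N) (L := L) a (θ := 1) (r := 3) one_pos ?_
  · norm_num at h
    exact h
  · intro u
    have : Metric.ball u 3 = Set.univ := by
      refine Set.eq_univ_of_forall fun v => ?_
      have h1 : ‖v.1‖ = 1 := by simp
      have h2 : ‖u.1‖ = 1 := by simp
      have := norm_sub_le v.1 u.1
      rw [Metric.mem_ball, Subtype.dist_eq, dist_eq_norm]
      linarith
    rw [this]
    simp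

end InfoBound

/-! ### Three bounds on the information, affine in the energy -/

section AffineBounds

variable {N L : ℕ} [NeZero L]

lemma sq_div_one_add_le (a : ℝ≥0) : (a : ℝ) ^ 2 / (1 + a) ≤ a := by
  rw [div_le_iff₀ (by positivity)]
  nlinarith [a.coe_nonneg]

lemma sq_div_one_add_le_sq (a : ℝ≥0) : (a : ℝ) ^ 2 / (1 + a) ≤ a ^ 2 :=
  div_le_self (by positivity) (by simp)

lemma ofReal_mul_coe {d : ℝ} (hd : 0 ≤ d) (a : ℝ≥0) :
    ENNReal.ofReal (d * a) = ENNReal.ofReal d * a := by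
  rw [ENNReal.ofReal_mul hd, ENNReal.ofReal_coe_nnreal]

lemma mutualInfo_le_linear (a : ℝ≥0) :
    mutualInfo (shapeOutputLaw N L a) ≤ ENNReal.ofReal (9 * N) * a := by
  rw [← ofReal_mul_coe (by positivity)]
  refine (mutualInfo_shapeOutputLaw_le_quadratic a).trans (ENNReal.ofReal_le_ofReal ?_)
  have := mul_le_mul_of_nonneg_left (sq_div_one_add_le a) (Nat.cast_nonneg (α := ℝ) N)
  linarith

/-- The radius `1/√N` cancels the factor `N` in the divergence, leaving at most `a`. -/
lemma mutualInfo_le_log (hN : 0 < N) (a : ℝ≥0) :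
    mutualInfo (shapeOutputLaw N L a) ≤
      ENNReal.ofReal (L * Real.log (16 * N)) + ENNReal.ofReal 1 * a := by
  have hN1 : (1 : ℝ) ≤ N := by exact_mod_cast hN
  have hN0 : (0 : ℝ) < N := by linarith
  have hlog : 0 ≤ Real.log (16 * N) := Real.log_nonneg (by linarith)
  have hr : (Real.sqrt N)⁻¹ ≤ 2 :=
    (inv_le_one_of_one_le₀ (Real.one_le_sqrt.2 hN1)).trans one_le_two
  rw [← ofReal_mul_coe zero_le_one, ← ENNReal.ofReal_add (by positivity) (by positivity)]
  refine (mutualInfo_shapeOutputLaw_le a (r := (Real.sqrt N)⁻¹) (by positivity) hr).trans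
    (ENNReal.ofReal_le_ofReal ?_)
  rw [inv_pow, Real.sq_sqrt hN0.le, div_inv_eq_mul]
  have := sq_div_one_add_le a
  have h2 : (N : ℝ) * ((a : ℝ) ^ 2 / (1 + a)) * (N : ℝ)⁻¹ = a ^ 2 / (1 + a) := by
    field_simp
  rw [h2]
  linarith

lemma mutualInfo_le_sqrt (hN : 0 < N) (a : ℝ≥0) :
    mutualInfo (shapeOutputLaw N L a) ≤ ENNReal.ofReal (9 * Real.sqrt (N * L)) * a := by
  have hN0 : (0 : ℝ) < N := by exact_mod_cast hN
  have hL0 : (0 : ℝ) < L := by exact_mod_cast Nat.pos_of_ne_zero (NeZero.ne L)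
  have ha := a.coe_nonneg
  rw [← ofReal_mul_coe (by positivity), Real.sqrt_mul hN0.le]
  set p := Real.sqrt N with hp
  set q := Real.sqrt L with hq
  have hp0 : 0 < p := Real.sqrt_pos.2 hN0
  have hq0 : 0 < q := Real.sqrt_pos.2 hL0
  have hpN : (N : ℝ) = p ^ 2 := (Real.sq_sqrt hN0.le).symm
  have hqL : (L : ℝ) = q ^ 2 := (Real.sq_sqrt hL0.le).symm
  have hsq := mul_le_mul_of_nonneg_left (sq_div_one_add_le_sq a) (Nat.cast_nonneg (α := ℝ) N)
  -- The cap radius `q / (a * p)` makes `N a² r²` equal to `L`. It is used only when it is at most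
  -- `1`; otherwise the whole sphere suffices, since then `N a² ≤ √(NL) a`.
  rcases le_total (a * p) q with hs | hs
  · refine (mutualInfo_shapeOutputLaw_le_quadratic a).trans (ENNReal.ofReal_le_ofReal ?_)
    have h1 : (N : ℝ) * a ^ 2 ≤ p * q * a := by
      rw [hpN]
      calc p ^ 2 * (a : ℝ) ^ 2 = p * a * (a * p) := by ring
        _ ≤ p * a * q := by gcongr
        _ = p * q * a := by ring
    linarith
  · have hap : 0 < a * p := hq0.trans_le hs
    have ha0 : (0 : ℝ) < a := pos_of_mul_pos_left hap hp0.le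
    have hr : q / (a * p) ≤ 2 := ((div_le_one hap).2 hs).trans one_le_two
    refine (mutualInfo_shapeOutputLaw_le a (r := q / (a * p)) (by positivity) hr).trans
      (ENNReal.ofReal_le_ofReal ?_)
    have h16 : (16 : ℝ) / (q / (a * p)) ^ 2 = (4 * (a * p / q)) ^ 2 := by
      field_simp
      norm_num
    -- The inequality `log x ≤ x - 1` at `x = 4 (a * p / q)` trades the logarithm for a linear term;
    -- the spare `-2` absorbs the divergence contribution `L`.
    have hlog : Real.log (16 / (q / (a * p)) ^ 2) ≤ 8 * (a * p / q) - 2 := by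
      rw [h16, Real.log_pow]
      have := Real.log_le_sub_one_of_pos (show 0 < 4 * (a * p / q) by positivity)
      push_cast
      linarith
    calc (L : ℝ) * Real.log (16 / (q / (a * p)) ^ 2)
          + N * ((a : ℝ) ^ 2 / (1 + a)) * (q / (a * p)) ^ 2
        ≤ L * (8 * (a * p / q) - 2) + N * a ^ 2 * (q / (a * p)) ^ 2 := by gcongr
      _ = 8 * (p * q * a) - q ^ 2 := by
          rw [hpN, hqL]
          field_simp
          ring
      _ ≤ 9 * (p * q) * a := by
          have : 0 ≤ p * q * a := by positivity
          nlinarith [sq_nonneg q]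

end AffineBounds

/-! ### From information bounds to capacity bounds -/

section Capacity

variable {P Δf : ℝ} {B N L : ℕ}

/-- An affine bound sees the law of `a` only through its mean, at most `P L / M`. Multiplying by `M
Δf / L` makes the linear term independent of `M` and `L`; the constant term is largest at `M = B`.
-/
lemma shapeCapacity_le_of_affine (hP : 0 < P) (hΔf : 0 < Δf) (hL : 0 < L) {c d : ℝ}
    (hc : 0 ≤ c) (hd : 0 ≤ d)
    (h : ∀ a, mutualInfo (shapeOutputLaw N L a) ≤ ENNReal.ofReal c + ENNReal.ofReal d * a) :
    shapeCapacity P Δf B N L ≤ ENNReal.ofReal (Δf * (B * c / L + d * P)) := by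
  have hL0 : (0 : ℝ) < L := by exact_mod_cast hL
  refine iSup_le fun M => iSup_le fun hM => iSup_le fun p => iSup_le fun hp => iSup_le fun ha => ?_
  have hM0 : (0 : ℝ) < M := by exact_mod_cast hM.1
  have hMB : (M : ℝ) ≤ B := by exact_mod_cast hM.2
  have hinfo : shapeInfo N L p ≤ ENNReal.ofReal (c + d * (P * L / M)) := by
    calc shapeInfo N L p ≤ ∫⁻ a, (ENNReal.ofReal c + ENNReal.ofReal d * a) ∂p :=
          lintegral_mono h
      _ = ENNReal.ofReal c + ENNReal.ofReal d * ∫⁻ a, (a : ℝ≥0∞) ∂p := by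
          rw [lintegral_add_left measurable_const, lintegral_const_mul _ (by fun_prop)]
          simp
      _ ≤ ENNReal.ofReal c + ENNReal.ofReal d * ENNReal.ofReal (P * L / M) := by gcongr
      _ = _ := by
          rw [← ENNReal.ofReal_mul hd, ← ENNReal.ofReal_add hc (by positivity)]
  calc ENNReal.ofReal (M * Δf / L) * shapeInfo N L p
      ≤ ENNReal.ofReal (M * Δf / L) * ENNReal.ofReal (c + d * (P * L / M)) := by gcongr
    _ = ENNReal.ofReal (Δf * (M * c / L + d * P)) := by
        rw [← ENNReal.ofReal_mul (by positivity)]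
        congr 1
        field_simp
    _ ≤ _ := by gcongr

lemma shapeCapacity_le_linear (hP : 0 < P) (hΔf : 0 < Δf) (hL : 0 < L) :
    shapeCapacity P Δf B N L ≤ ENNReal.ofReal (9 * Δf * P * N) := by
  have : NeZero L := ⟨hL.ne'⟩
  refine (shapeCapacity_le_of_affine hP hΔf hL le_rfl (by positivity : (0 : ℝ) ≤ 9 * N)
    fun a => (mutualInfo_le_linear a).trans (by simp)).trans (ENNReal.ofReal_le_ofReal ?_)
  rw [mul_zero, zero_div, zero_add]
  exact le_of_eq (by ring)

lemma shapeCapacity_le_sqrt (hP : 0 < P) (hΔf : 0 < Δf) (hL : 0 < L) (hN : 0 < N) :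
    shapeCapacity P Δf B N L ≤ ENNReal.ofReal (9 * Δf * P * Real.sqrt (N * L)) := by
  have : NeZero L := ⟨hL.ne'⟩
  refine (shapeCapacity_le_of_affine hP hΔf hL le_rfl
    (by positivity : (0 : ℝ) ≤ 9 * Real.sqrt (N * L))
    fun a => (mutualInfo_le_sqrt hN a).trans (by simp)).trans (ENNReal.ofReal_le_ofReal ?_)
  rw [mul_zero, zero_div, zero_add]
  exact le_of_eq (by ring)

lemma shapeCapacity_le_log (hP : 0 < P) (hΔf : 0 < Δf) (hB : 0 < B) (hL : 0 < L) (hN : 16 ≤ N) :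
    shapeCapacity P Δf B N L ≤ ENNReal.ofReal (Δf * (2 + P) * (B * Real.log N)) := by
  have : NeZero L := ⟨hL.ne'⟩
  have hL0 : (0 : ℝ) < L := by exact_mod_cast hL
  have hB1 : (1 : ℝ) ≤ B := by exact_mod_cast hB
  have hN16 : (16 : ℝ) ≤ N := by exact_mod_cast hN
  have hlogN : 1 ≤ Real.log N := by
    rw [Real.le_log_iff_exp_le (by linarith)]
    linarith [Real.exp_one_lt_d9]
  -- The assumption `16 ≤ N` absorbs the constant `16` into a second `log N`, and also gives `log N
  -- ≥ 1`, so that `P` is absorbed into `B log N`.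
  have hlog : Real.log (16 * N) ≤ 2 * Real.log N := by
    rw [Real.log_mul (by norm_num) (by linarith)]
    linarith [Real.log_le_log (by norm_num) hN16]
  have hlog0 : 0 ≤ Real.log (16 * N) := Real.log_nonneg (by linarith)
  refine (shapeCapacity_le_of_affine hP hΔf hL (by positivity) zero_le_one
    (mutualInfo_le_log (by lia))).trans (ENNReal.ofReal_le_ofReal ?_)
  have h1 : (B : ℝ) * (L * Real.log (16 * N)) / L = B * Real.log (16 * N) := by
    field_simp
  have h2 : (1 : ℝ) ≤ B * Real.log N := one_le_mul_of_one_le_of_one_le hB1 hlogN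
  rw [h1, mul_assoc]
  gcongr
  calc (B : ℝ) * Real.log (16 * N) + 1 * P
      ≤ B * (2 * Real.log N) + (B * Real.log N) * P := by gcongr
    _ = _ := by ring

end Capacity

/-! ### Exponents and orders of growth in `N` -/

section Asymptotics

lemma eventually_log_ge_one : ∀ᶠ N : ℕ in atTop, 1 ≤ Real.log N :=
  (Real.tendsto_log_atTop.comp tendsto_natCast_atTop_atTop).eventually_ge_atTop 1

lemma HasExponent.eventually_le {f : ℕ → ℕ} {s : ℝ} (hf : ∀ N, 0 < f N) (h : HasExponent f s)
    {t : ℝ} (ht : s < t) : ∀ᶠ N : ℕ in atTop, (f N : ℝ) ≤ 1 * (N : ℝ) ^ t := by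
  filter_upwards [h.eventually_lt_const ht, eventually_log_ge_one, eventually_gt_atTop 0]
    with N hN hlog hpos
  have hN0 : (0 : ℝ) < N := by exact_mod_cast hpos
  have hf0 : (0 : ℝ) < f N := by exact_mod_cast hf N
  rw [div_lt_iff₀ (by linarith)] at hN
  rw [one_mul, Real.rpow_def_of_pos hN0, ← Real.log_le_iff_le_exp hf0]
  linarith

lemma eventually_le_of_isTheta {f : ℕ → ℕ} {s : ℝ}
    (h : (fun N : ℕ => (f N : ℝ)) =Θ[atTop] fun N : ℕ => (N : ℝ) ^ s) :
    ∃ c : ℝ, ∀ᶠ N : ℕ in atTop, (f N : ℝ) ≤ c * (N : ℝ) ^ s := by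
  obtain ⟨c, hc⟩ := h.1.bound
  refine ⟨c, hc.mono fun N hN => ?_⟩
  rwa [Real.norm_of_nonneg (by positivity), Real.norm_of_nonneg (by positivity)] at hN

lemma AtMostOrder.mul_log {F : ℕ → ℝ≥0∞} {s : ℝ} (h : AtMostOrder F fun N => (N : ℝ) ^ s) :
    AtMostOrder F fun N => (N : ℝ) ^ s * Real.log N := by
  obtain ⟨C, hC⟩ := h
  refine ⟨|C|, ?_⟩
  filter_upwards [hC, eventually_log_ge_one] with N hN hlog
  refine hN.trans (ENNReal.ofReal_le_ofReal ?_)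
  calc C * (N : ℝ) ^ s ≤ |C| * (N : ℝ) ^ s := by gcongr; exact le_abs_self C
    _ ≤ |C| * ((N : ℝ) ^ s * Real.log N) := by
      gcongr
      exact le_mul_of_one_le_right (by positivity) hlog

lemma AtMostOrder.mono_exponent {F : ℕ → ℝ≥0∞} {s t : ℝ} (hst : s ≤ t)
    (h : AtMostOrder F fun N => (N : ℝ) ^ s) : AtMostOrder F fun N => (N : ℝ) ^ t := by
  obtain ⟨C, hC⟩ := h
  refine ⟨|C|, ?_⟩
  filter_upwards [hC, eventually_ge_atTop 1] with N hN hpos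
  have hN1 : (1 : ℝ) ≤ N := by exact_mod_cast hpos
  refine hN.trans (ENNReal.ofReal_le_ofReal ?_)
  calc C * (N : ℝ) ^ s ≤ |C| * (N : ℝ) ^ s := by gcongr; exact le_abs_self C
    _ ≤ |C| * (N : ℝ) ^ t := by gcongr

/-- Half of `δ` is spent on the exponent `t = s + δ / 2`; the other half dominates `C log N`. -/
lemma exponentAtMost_of_atMostOrder {F : ℕ → ℝ≥0∞} {s : ℝ}
    (h : ∀ t, s < t → AtMostOrder F fun N => (N : ℝ) ^ t * Real.log N) : ExponentAtMost F s := by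
  intro δ hδ
  obtain ⟨C, hC⟩ := h (s + δ / 2) (by linarith)
  have hlittle := ((isLittleO_log_rpow_atTop (half_pos hδ)).comp_tendsto
    tendsto_natCast_atTop_atTop).const_mul_left C
  have hbound := hlittle.bound one_pos
  filter_upwards [hC, hbound, eventually_gt_atTop 0] with N hN hb hpos
  have hN0 : (0 : ℝ) < N := by exact_mod_cast hpos
  refine hN.trans (ENNReal.ofReal_le_ofReal ?_)
  have hb' : C * Real.log N ≤ (N : ℝ) ^ (δ / 2) := by
    have h1 := (le_abs_self _).trans hb
    simpa [abs_of_nonneg (Real.rpow_nonneg hN0.le (δ / 2))] using h1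
  calc C * ((N : ℝ) ^ (s + δ / 2) * Real.log N) = (N : ℝ) ^ (s + δ / 2) * (C * Real.log N) := by
        ring
    _ ≤ (N : ℝ) ^ (s + δ / 2) * (N : ℝ) ^ (δ / 2) := by gcongr
    _ = (N : ℝ) ^ (s + δ) := by
        rw [← Real.rpow_add hN0]
        congr 1
        ring

variable {P Δf : ℝ} {B L : ℕ → ℕ}

lemma atMostOrder_one (hP : 0 < P) (hΔf : 0 < Δf) (hL : ∀ N, 0 < L N) :
    AtMostOrder (fun N => shapeCapacity P Δf (B N) N (L N)) fun N => (N : ℝ) ^ (1 : ℝ) :=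
  ⟨9 * Δf * P, Eventually.of_forall fun N => by
    simpa using shapeCapacity_le_linear hP hΔf (hL N)⟩

lemma atMostOrder_bandwidth (hP : 0 < P) (hΔf : 0 < Δf) (hB : ∀ N, 0 < B N)
    (hL : ∀ N, 0 < L N) {c s : ℝ} (h : ∀ᶠ N : ℕ in atTop, (B N : ℝ) ≤ c * (N : ℝ) ^ s) :
    AtMostOrder (fun N => shapeCapacity P Δf (B N) N (L N))
      fun N => (N : ℝ) ^ s * Real.log N := by
  refine ⟨Δf * (2 + P) * c, ?_⟩
  filter_upwards [h, eventually_ge_atTop 16, eventually_log_ge_one] with N hN h16 hlog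
  refine (shapeCapacity_le_log hP hΔf (hB N) (hL N) h16).trans (ENNReal.ofReal_le_ofReal ?_)
  calc Δf * (2 + P) * (B N * Real.log N)
      ≤ Δf * (2 + P) * (c * (N : ℝ) ^ s * Real.log N) := by gcongr
    _ = _ := by ring

lemma atMostOrder_coherence (hP : 0 < P) (hΔf : 0 < Δf)
    (hL : ∀ N, 0 < L N) {c t : ℝ} (h : ∀ᶠ N : ℕ in atTop, (L N : ℝ) ≤ c * (N : ℝ) ^ t) :
    AtMostOrder (fun N => shapeCapacity P Δf (B N) N (L N)) fun N => (N : ℝ) ^ ((1 + t) / 2) := by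
  refine ⟨9 * Δf * P * Real.sqrt c, ?_⟩
  filter_upwards [h, eventually_gt_atTop 0] with N hN hpos
  have hN0 : (0 : ℝ) < N := by exact_mod_cast hpos
  refine (shapeCapacity_le_sqrt hP hΔf (hL N) hpos).trans (ENNReal.ofReal_le_ofReal ?_)
  have hmul : (N : ℝ) * (c * (N : ℝ) ^ t) = (N : ℝ) ^ (1 + t) * c := by
    rw [Real.rpow_add hN0, Real.rpow_one]; ring
  have hs : Real.sqrt (N * L N) ≤ Real.sqrt c * (N : ℝ) ^ ((1 + t) / 2) := by
    calc Real.sqrt (N * L N) ≤ Real.sqrt ((N : ℝ) ^ (1 + t) * c) := by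
          rw [← hmul]; gcongr
      _ = Real.sqrt c * (N : ℝ) ^ ((1 + t) / 2) := by
          rw [Real.sqrt_mul (by positivity), Real.sqrt_eq_rpow ((N : ℝ) ^ (1 + t)),
            ← Real.rpow_mul hN0.le, mul_comm, mul_one_div]
  rw [mul_assoc (9 * Δf * P)]
  gcongr

end Asymptotics

end ShapeEncoding

end

theorem mainTheorem3 (P Δf : ℝ) (hP : 0 < P) (hΔf : 0 < Δf)
    (ε τ : ℝ) (hε : 0 ≤ ε) (hτ : 0 ≤ τ)
    (B L : ℕ → ℕ) (hB : ∀ N, 0 < B N) (hL : ∀ N, 0 < L N) :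
    (ShapeEncoding.HasExponent B ε → ShapeEncoding.HasExponent L τ →
      ShapeEncoding.ExponentAtMost
        (fun N => ShapeEncoding.shapeCapacity P Δf (B N) N (L N))
        (min ε (min ((1 + τ) / 2) 1))) ∧
    ((fun N : ℕ => (B N : ℝ)) =Θ[atTop] (fun N : ℕ => (N : ℝ) ^ ε) →
      (fun N : ℕ => (L N : ℝ)) =Θ[atTop] (fun N : ℕ => (N : ℝ) ^ τ) →
      ShapeEncoding.AtMostOrder
        (fun N => ShapeEncoding.shapeCapacity P Δf (B N) N (L N))
        (fun N => (N : ℝ) ^ (min ε (min ((1 + τ) / 2) 1)) * Real.log N) ∧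
      (min ((1 + τ) / 2) 1 ≤ ε →
        ShapeEncoding.AtMostOrder
          (fun N => ShapeEncoding.shapeCapacity P Δf (B N) N (L N))
          (fun N => (N : ℝ) ^ (min ε (min ((1 + τ) / 2) 1))))) := by
  refine ⟨fun hBe hLe => ShapeEncoding.exponentAtMost_of_atMostOrder fun t ht => ?_,
    fun hBe hLe => ?_⟩
  · rcases min_lt_iff.1 ht with ht | ht
    · exact ShapeEncoding.atMostOrder_bandwidth hP hΔf hB hL (hBe.eventually_le hB ht)
    · rcases min_lt_iff.1 ht with ht | ht
      -- The exponent `2t - 1` for `L` is the one for which `(1 + (2t - 1)) / 2 = t`, and it exceeds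
      -- `τ` exactly because `(1 + τ) / 2 < t`.
      · have h := ShapeEncoding.atMostOrder_coherence (B := B) hP hΔf hL
          (hLe.eventually_le hL (show τ < 2 * t - 1 by linarith))
        exact (h.mono_exponent (by linarith)).mul_log
      · exact ((ShapeEncoding.atMostOrder_one hP hΔf hL).mono_exponent ht.le).mul_log
  · obtain ⟨c, hc⟩ := ShapeEncoding.eventually_le_of_isTheta hBe
    obtain ⟨c', hc'⟩ := ShapeEncoding.eventually_le_of_isTheta hLe
    -- The antenna and coherence bounds carry no logarithm, which gives the sharper order once `ε`
    -- is not the strict minimum.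
    have hsharp : ShapeEncoding.AtMostOrder
        (fun N => ShapeEncoding.shapeCapacity P Δf (B N) N (L N))
        (fun N => (N : ℝ) ^ (min ((1 + τ) / 2) 1)) := by
      rcases min_choice ((1 + τ) / 2) 1 with h | h <;> rw [h]
      · exact ShapeEncoding.atMostOrder_coherence hP hΔf hL hc'
      · exact ShapeEncoding.atMostOrder_one hP hΔf hL
    refine ⟨?_, fun hle => by rwa [min_eq_right hle]⟩
    rcases min_choice ε (min ((1 + τ) / 2) 1) with h | h <;> rw [h]
    · exact ShapeEncoding.atMostOrder_bandwidth hP hΔf hB hL hc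
    · exact hsharp.mul_log
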